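/- Let $S$ be a finite monoid with neutral element $e$ and let $A$ be a finite set. An *$S$-operation* on $A$ is an operation $f\colon A^n\to A$ ($n\ge 1$) together with a *signum* $\operatorname{sgn}(f)=(s_1,\dots,s_n)\in S^n$; let ${}^S\mathrm{Op}(A)$ be the set of all of them. For an operation $g$ and $\lambda\in S^n$, $g^\lambda$ denotes $g$ with signum $\lambda$, and $\mathrm{id}^s$ the identity function with signum $(s)$. A set $F\subseteq{}^S\mathrm{Op}(A)$ is an *$S$-preclone* if $\mathrm{id}^e\in F$ and $F$ is closed under the following operations, where $\operatorname{sgn}(f)=(s_1,\dots,s_n)$ and $\operatorname{sgn}(g)=(s'_1,\dots,s'_m)$: * $(\zeta f)(x_1,\dots,x_n)=f(x_2,\dots,x_n,x_1)$ with signum $(s_n,s_1,\dots,s_{n-1})$, and $(\tau f)(x_1,\dots,x_n)=f(x_2,x_1,x_3,\dots,x_n)$ with signum $(s_2,s_1,s_3,\dots,s_n)$ (for $n=1$, $\zeta f=\tau f=f$); * $(\nabla^s f)(x_1,\dots,x_{n+1})=f(x_2,\dots,x_{n+1})$ with signum $(s,s_1,\dots,s_n)$, for each $s\in S$; * $(\Delta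 f)(x_1,\dots,x_{n-1})=f(x_1,x_1,x_2,\dots,x_{n-1})$ with signum $(s_2,s_3,\dots,s_n)$ if $n\ge2$ and $s_1=s_2$, and $\Delta f=f$ otherwise; * $(f\circ g)(x_1,\dots,x_{m+n-1})=f(g(x_1,\dots,x_m),x_{m+1},\dots,x_{m+n-1})$ with signum $(s'_1s_1,\dots,s'_ms_1,s_2,\dots,s_n)$. An *$S$-relation* on $A$ is a family $\rho=(\rho_s)_{s\in S}$ of relations $\rho_s\subseteq A^m$ of a common arity $m\ge1$; let ${}^S\mathrm{Rel}(A)$ be the set of all of them. A set of $S$-relations is an *$S$-relational clone* if it contains $(\Delta_A)_{s\in S}$, where $\Delta_A$ is the equality relation, and is closed under the following operations: the componentwise operations of cyclic shift of rows, transposition of the first two rows, deletion of the first row (each of these three leaves unary relations unchanged), Cartesian product, and intersection (for different arities the intersection is the empty $S$-relation of the arity of the first argument); and, for each $v\in S$, the index translation $\rho\mapsto(\rho_{sv})_{s\in S}$ and the $v$-self-intersection $\rho\mapsto\bigl(\bigcap\{\rho_t\mid t\in S,\ tv=s\}\bigr)_{s\in S}$ (an empty intersection being $A^m$). The $S$-preclone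 (respectively $S$-relational clone) *generated* by a set is the least one containing it. The $S$-preclones on $A$, ordered by inclusion, form a lattice. Then: 1. The $S$-preclone ${}^S\mathrm{Op}(A)$ is finitely generated. For instance, for $A=\{0,1,\dots,k-1\}$, it is generated by $\{m^{(e,e)}\}\cup\{\mathrm{id}^s\mid s\in S\}$, where $m(x,y)=\max(x,y)\oplus1$ and $\oplus$ is addition modulo $k$. 2. The $S$-relational clone ${}^S\mathrm{Rel}(A)$ is finitely generated. For instance, for $A=\{0,1,\dots,k-1\}$ with $k\ge3$, it is generated by the three binary $S$-relations $(\Delta,\nabla,\dots,\nabla)$, $(\le,\le,\dots,\le)$ and $(\ne,\ne,\dots,\ne)$, where $\nabla=A^2$ and $(\sigma,\sigma',\dots,\sigma')$ denotes the $S$-relation $\rho$ with $\rho_e=\sigma$ and $\rho_s=\sigma'$ for all $s\in S\setminus\{e\}$. 3. The lattice of $S$-preclones on $A$ is atomic and coatomic: each $S$-preclone other than the least one contains an atom (a minimal $S$-preclone), and each $S$-preclone other than ${}^S\mathrm{Op}(A)$ is contained in a coatom (a maximal $S$-preclone). -/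

import Mathlib

universe u v

/-- A signed operation on `A` over the label set `S`: an operation `A ^ (pred + 1) → A` of positive
arity `pred + 1`, together with its signum, a label in `S` for each argument. Arguments are numbered
`0, …, pred`. -/
@[ext]
structure SOp (S : Type u) (A : Type v) where
  /-- The arity minus one. -/
  pred : ℕ
  /-- The signum. -/
  sgn : Fin (pred + 1) → S
  /-- The underlying function. -/
  fn : (Fin (pred + 1) → A) → A

namespace SOp

variable {S : Type u} {A : Type v}

/-- The unary operation `id ^ s`: the identity function with signum `(s)`. -/
def idOp (A : Type v) (s : S) : SOp S A where
  pred := 0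
  sgn := fun _ => s
  fn := fun x => x 0

/-- Cyclic shift: `(ζ f)(x₁, …, xₙ) = f(x₂, …, xₙ, x₁)`, with signum `(sₙ, s₁, …, sₙ₋₁)`. Addition
in `Fin (pred + 1)` is cyclic; for a unary `f` this is `f` itself. -/
def zeta (f : SOp S A) : SOp S A where
  pred := f.pred
  sgn := fun i => f.sgn (i - 1)
  fn := fun x => f.fn (fun i => x (i + 1))

/-- Permuting the first two arguments and their labels. For a unary `f` we have `1 = 0` in
`Fin (pred + 1)`, and this is `f` itself. -/
def tau (f : SOp S A) : SOp S A where
  pred := f.pred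
  sgn := fun i => f.sgn (Equiv.swap 0 1 i)
  fn := fun x => f.fn (fun i => x (Equiv.swap 0 1 i))

/-- Adding a fictitious argument with label `s` at the first place. -/
def nabla (s : S) (f : SOp S A) : SOp S A where
  pred := f.pred + 1
  sgn := Fin.cons s f.sgn
  fn := fun x => f.fn (Fin.tail x)

open Classical in
/-- Identification of the first two arguments, if there are at least two arguments and the first two
have the same label; otherwise `f` is returned unchanged. -/
noncomputable def delta : SOp S A → SOp S A
  | ⟨0, sgn, fn⟩ => ⟨0, sgn, fn⟩
  | ⟨n + 1, sgn, fn⟩ =>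
      if sgn 0 = sgn 1 then ⟨n, Fin.tail sgn, fun x => fn (Fin.cons (x 0) x)⟩
      else ⟨n + 1, sgn, fn⟩

/-- Composition: for `f` of arity `n` and `g` of arity `m`,
`(f ∘ g)(x₁, …, xₘ₊ₙ₋₁) = f(g(x₁, …, xₘ), xₘ₊₁, …, xₘ₊ₙ₋₁)`, with signum
`(s'₁ s₁, …, s'ₘ s₁, s₂, …, sₙ)`. -/
def comp [Mul S] (f g : SOp S A) : SOp S A where
  pred := g.pred + f.pred
  sgn := fun i =>
    if h : (i : ℕ) < g.pred + 1 then g.sgn ⟨i, h⟩ * f.sgn 0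
    else f.sgn ⟨i - g.pred, by omega⟩
  fn := fun x =>
    f.fn (Fin.cons (g.fn (fun i : Fin (g.pred + 1) => x ⟨i, by omega⟩))
      (fun j : Fin f.pred => x ⟨g.pred + 1 + j, by omega⟩))

/-- The binary signed operation with underlying function `m` and signum `(s, t)`. -/
def binary (s t : S) (m : A → A → A) : SOp S A where
  pred := 1
  sgn := ![s, t]
  fn := fun x => m (x 0) (x 1)

end SOp

/-- A set of signed operations is an `S`-preclone if it contains `id_A` (with the neutral element of
`S` as its label) and is closed under the five operations above. -/
structure IsSPreclone {S : Type u} {A : Type v} [Monoid S] (F : Set (SOp S A)) : Prop where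
  id_mem : SOp.idOp A (1 : S) ∈ F
  zeta_mem : ∀ f ∈ F, f.zeta ∈ F
  tau_mem : ∀ f ∈ F, f.tau ∈ F
  nabla_mem : ∀ s : S, ∀ f ∈ F, f.nabla s ∈ F
  delta_mem : ∀ f ∈ F, f.delta ∈ F
  comp_mem : ∀ f ∈ F, ∀ g ∈ F, f.comp g ∈ F

/-- The `S`-preclone generated by `F`: the least `S`-preclone containing `F`. -/
def precloneClosure {S : Type u} {A : Type v} [Monoid S] (F : Set (SOp S A)) : Set (SOp S A) :=
  ⋂₀ {P | IsSPreclone P ∧ F ⊆ P}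

theorem IsSPreclone.sInter {S : Type u} {A : Type v} [Monoid S] {C : Set (Set (SOp S A))}
    (hC : ∀ P ∈ C, IsSPreclone P) : IsSPreclone (⋂₀ C) where
  id_mem := fun P hP => (hC P hP).id_mem
  zeta_mem := fun f hf P hP => (hC P hP).zeta_mem f (hf P hP)
  tau_mem := fun f hf P hP => (hC P hP).tau_mem f (hf P hP)
  nabla_mem := fun s f hf P hP => (hC P hP).nabla_mem s f (hf P hP)
  delta_mem := fun f hf P hP => (hC P hP).delta_mem f (hf P hP)
  comp_mem := fun f hf g hg P hP => (hC P hP).comp_mem f (hf P hP) g (hg P hP)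

/-- The type of all `S`-preclones on `A`, ordered by inclusion. -/
abbrev SPreclone (S : Type u) (A : Type v) [Monoid S] : Type (max u v) :=
  {F : Set (SOp S A) // IsSPreclone F}

/-- The `S`-preclones on `A` form a complete lattice with respect to inclusion; infima are
intersections. -/
noncomputable instance SPreclone.instCompleteLattice (S : Type u) (A : Type v) [Monoid S] :
    CompleteLattice (SPreclone S A) :=
  letI : InfSet (SPreclone S A) :=
    ⟨fun C => ⟨⋂₀ (Subtype.val '' C), IsSPreclone.sInter (by rintro _ ⟨P, -, rfl⟩; exact P.2)⟩⟩
  completeLatticeOfInf (SPreclone S A) (fun C =>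
    ⟨fun P hP _ hf => hf P.1 ⟨P, hP, rfl⟩,
      fun Q hQ f hf => by rintro _ ⟨P, hP, rfl⟩; exact hQ hP hf⟩)

/-- An `S`-relation on `A`: a family, indexed by `S`, of relations on `A` of one common positive
arity `pred + 1`. -/
@[ext]
structure SRel (S : Type u) (A : Type v) where
  /-- The arity minus one. -/
  pred : ℕ
  /-- The components. -/
  rel : S → Set (Fin (pred + 1) → A)

namespace SRel

variable {S : Type u} {A : Type v}

/-- The `S`-relation all of whose components are the equality relation. -/
def diag (S : Type u) (A : Type v) : SRel S A where
  pred := 1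
  rel := fun _ => {a | a 0 = a 1}

/-- Cyclic shift of rows: `(a₁, a₂, …, aₘ)` is replaced by `(a₂, …, aₘ, a₁)`. For arity one this is
the identity. -/
def zeta (ρ : SRel S A) : SRel S A where
  pred := ρ.pred
  rel := fun s => (fun a i => a (i + 1)) '' ρ.rel s

/-- Transposition of the first two rows. For arity one this is the identity. -/
def tau (ρ : SRel S A) : SRel S A where
  pred := ρ.pred
  rel := fun s => (fun a i => a (Equiv.swap 0 1 i)) '' ρ.rel s

/-- Deletion of the first row. For arity one this is the identity. -/
def pr : SRel S A → SRel S A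
  | ⟨0, rel⟩ => ⟨0, rel⟩
  | ⟨m + 1, rel⟩ => ⟨m, fun s => Fin.tail '' rel s⟩

/-- Cartesian product. -/
def prod (ρ σ : SRel S A) : SRel S A where
  pred := ρ.pred + σ.pred + 1
  rel := fun s => {a |
    (fun i : Fin (ρ.pred + 1) => a ⟨i, by omega⟩) ∈ ρ.rel s ∧
    (fun j : Fin (σ.pred + 1) => a ⟨ρ.pred + 1 + j, by omega⟩) ∈ σ.rel s}

/-- Intersection. If the arities differ, the result is the empty `S`-relation of the arity
of `ρ`. -/
def inter (ρ σ : SRel S A) : SRel S A where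
  pred := ρ.pred
  rel := fun s => {a | a ∈ ρ.rel s ∧
    ∃ h : σ.pred = ρ.pred, (fun i => a (Fin.cast (by rw [h]) i)) ∈ σ.rel s}

/-- Index translation by `v`. -/
def translate [Mul S] (v : S) (ρ : SRel S A) : SRel S A where
  pred := ρ.pred
  rel := fun s => ρ.rel (s * v)

/-- `v`-self-intersection. The component at `s` is full if there is no `t` with `t * v = s`. -/
def selfInter [Mul S] (v : S) (ρ : SRel S A) : SRel S A where
  pred := ρ.pred
  rel := fun s => {a | ∀ t : S, t * v = s → a ∈ ρ.rel t}

open Classical in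
/-- The binary `S`-relation `(σ, σ', …, σ')`: its component at the neutral element is `σ`, all other
components are `σ'`. -/
def binary [One S] (σ σ' : A → A → Prop) : SRel S A where
  pred := 1
  rel := fun s => if s = 1 then {a | σ (a 0) (a 1)} else {a | σ' (a 0) (a 1)}

end SRel

/-- A set of `S`-relations is an `S`-relational clone if it contains the equality `S`-relation and is
closed under the seven kinds of operations above. -/
structure IsSRelClone {S : Type u} {A : Type v} [Monoid S] (Q : Set (SRel S A)) : Prop where
  diag_mem : SRel.diag S A ∈ Q
  zeta_mem : ∀ ρ ∈ Q, ρ.zeta ∈ Q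
  tau_mem : ∀ ρ ∈ Q, ρ.tau ∈ Q
  pr_mem : ∀ ρ ∈ Q, ρ.pr ∈ Q
  prod_mem : ∀ ρ ∈ Q, ∀ σ ∈ Q, ρ.prod σ ∈ Q
  inter_mem : ∀ ρ ∈ Q, ∀ σ ∈ Q, ρ.inter σ ∈ Q
  translate_mem : ∀ v : S, ∀ ρ ∈ Q, ρ.translate v ∈ Q
  selfInter_mem : ∀ v : S, ∀ ρ ∈ Q, ρ.selfInter v ∈ Q

/-- The `S`-relational clone generated by `Q`: the least `S`-relational clone containing `Q`. -/
def relCloneClosure {S : Type u} {A : Type v} [Monoid S] (Q : Set (SRel S A)) : Set (SRel S A) :=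
  ⋂₀ {C | IsSRelClone C ∧ Q ⊆ C}

/-- The function `max(x, y) ⊕ 1` on `{0, …, k - 1}`, where `⊕` is addition modulo `k`. -/
def webb (k : ℕ) (x y : Fin k) : Fin k :=
  ⟨(max (x : ℕ) (y : ℕ) + 1) % k, Nat.mod_lt _ x.pos⟩

/-! ### Calculus of signed operations with arguments indexed by finite types. -/

section IndexedOperations

/-! Throughout, operations and relations are indexed by arbitrary finite types (`HasOp`, `HasRel`),
so that the elementary operations become substitution of variables, composition and primitive
positive definition.

For operations, first give every argument the label `1`. Over `Fin k`, the functions on `A^n`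
obtained this way contain the projections, which separate points, and are closed under Webb's
function; `eq_univ_of_webb_mem` shows that they are all functions. Composing each argument with
`id^s` then replaces its label `1` by `s * 1 = s`.

For relations, `eq_univ_of_hasRel` reduces the problem to constant families. A relation placed at
index `1`, with full components elsewhere, is moved to index `v` by the `v`-self-intersection, and
intersecting over all `v` assembles an arbitrary family. Constant families in turn are projected
from the relation formed by all projections (`hasRel_const`). That relation is definable from
ternary relations (`exists_eq_proj_of_forall_three`), or from order and inequality when `k ≥ 3`
(`exists_eq_proj_of_preserves_le_ne`). In both cases the sets of coordinates deciding the value of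
the operation form an ultrafilter, principal by finiteness.

For the lattice, the least preclone consists of the projections to a coordinate labelled `1`. The
ternary criterion shows that any other operation has a minor of bounded arity outside it, so
finitely many operations meet every nontrivial preclone, which gives atoms. Coatoms follow from
finite generation by Zorn's lemma. -/

theorem Equiv.Perm.induction_finRotate_swap {n : ℕ} {p : Equiv.Perm (Fin (n + 1)) → Prop}
    (one : p 1) (mul : ∀ π π', p π → p π' → p (π * π'))
    (rot : p (finRotate (n + 1))) (swap : p (Equiv.swap 0 1)) (π : Equiv.Perm (Fin (n + 1))) :
    p π := by
  rcases n with _ | n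
  · rwa [show π = 1 from Equiv.ext fun i => Subsingleton.elim (α := Fin 1) _ _]
  · have hpow : ∀ π, p π → ∀ k : ℕ, p (π ^ k) := fun π hπ k => by
      induction k with
      | zero => simpa using one
      | succ k ih => rw [pow_succ]; exact mul _ _ ih hπ
    have htop := Equiv.Perm.closure_cycle_adjacent_swap (isCycle_finRotate (n := n))
      support_finRotate 0
    have hπ : π ∈ Subgroup.closure {finRotate (n + 2), Equiv.swap 0 (finRotate (n + 2) 0)} := by
      rw [htop]; trivial
    induction hπ using Subgroup.closure_induction with
    | mem x hx =>
      rcases hx with rfl | rfl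
      · exact rot
      · simpa using swap
    | one => exact one
    | mul x y _ _ hx hy => exact mul x y hx hy
    | inv x _ hx =>
      -- Only products are available, but in a finite group inverses are powers.
      have : x⁻¹ = x ^ (orderOf x - 1) := by
        rw [inv_eq_iff_mul_eq_one, ← pow_succ',
          Nat.sub_add_cancel (orderOf_pos x), pow_orderOf_eq_one]
      rw [this]; exact hpow x hx _

theorem exists_finSuccEquiv (ι : Type*) [Finite ι] [Nonempty ι] :
    ∃ n : ℕ, Nonempty (Fin (n + 1) ≃ ι) := by
  obtain ⟨n, ⟨e⟩⟩ := Finite.exists_equiv_fin ι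
  rcases n with _ | n
  · exact (IsEmpty.false (e (Classical.arbitrary ι))).elim
  · exact ⟨n, ⟨e.symm⟩⟩

variable {S : Type u} {A : Type v} {ι κ : Type*}

/-- The signed operation whose arguments are indexed by `ι` (of positive finite cardinality)
belongs to `F` for some enumeration of `ι`. -/
def HasOp (F : Set (SOp S A)) (sgn : ι → S) (fn : (ι → A) → A) : Prop :=
  ∃ (n : ℕ) (e : Fin (n + 1) ≃ ι), (⟨n, sgn ∘ e, fun x => fn (x ∘ e.symm)⟩ : SOp S A) ∈ F

theorem hasOp_of_mem {F : Set (SOp S A)} {f : SOp S A} (hf : f ∈ F) : HasOp F f.sgn f.fn :=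
  ⟨f.pred, Equiv.refl _, hf⟩

theorem hasOp_equiv {sgn : ι → S} {fn : (ι → A) → A} (h : HasOp F sgn fn)
    (e : ι ≃ κ) {sgn' : κ → S} (hs : ∀ i, sgn' (e i) = sgn i) :
    HasOp F sgn' (fun x => fn (x ∘ e)) := by
  obtain ⟨n, e', h⟩ := h
  refine ⟨n, e'.trans e, ?_⟩
  convert! h using 2
  · ext i; simp [hs]
  · ext x; simp [Function.comp_def]

theorem Equiv.optionCongr_symm_some (e : ι ≃ κ) (k : κ) :
    e.optionCongr.symm (some k) = some (e.symm k) := rfl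

theorem Equiv.optionCongr_symm_none (e : ι ≃ κ) : e.optionCongr.symm none = none := rfl

namespace IsSPreclone

variable [Monoid S] {F : Set (SOp S A)}

theorem perm_mem (hF : IsSPreclone F) {n : ℕ} (π : Equiv.Perm (Fin (n + 1))) :
    ∀ (sgn : Fin (n + 1) → S) (fn : (Fin (n + 1) → A) → A), (⟨n, sgn, fn⟩ : SOp S A) ∈ F →
      (⟨n, sgn ∘ π, fun x => fn (x ∘ π.symm)⟩ : SOp S A) ∈ F := by
  suffices H : ∀ (sgn : Fin (n + 1) → S) (fn : (Fin (n + 1) → A) → A),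
      (⟨n, sgn, fn⟩ : SOp S A) ∈ F →
      (⟨n, sgn ∘ π.symm, fun x => fn (x ∘ π)⟩ : SOp S A) ∈ F ∧
      (⟨n, sgn ∘ π, fun x => fn (x ∘ π.symm)⟩ : SOp S A) ∈ F from fun s f h => (H s f h).2
  suffices H : ∀ π : Equiv.Perm (Fin (n + 1)), ∀ (sgn : Fin (n + 1) → S)
      (fn : (Fin (n + 1) → A) → A), (⟨n, sgn, fn⟩ : SOp S A) ∈ F →
      (⟨n, sgn ∘ π.symm, fun x => fn (x ∘ π)⟩ : SOp S A) ∈ F from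
    fun s f h => ⟨H π s f h, H π.symm s f h⟩
  intro π
  induction π using Equiv.Perm.induction_finRotate_swap with
  | one => exact fun _ _ h => h
  | mul π π' h h' => exact fun s f hf => h _ _ (h' s f hf)
  | rot =>
    intro s f hf
    convert! hF.zeta_mem _ hf using 1
    have h1 : ∀ i, (finRotate (n + 1)).symm i = i - 1 := fun i => by
      rw [Equiv.symm_apply_eq, finRotate_apply, sub_add_cancel]
    have h2 : ∀ i, finRotate (n + 1) i = i + 1 := finRotate_apply
    simp [SOp.zeta, Function.comp_def, h1, h2, -finRotate_apply]
  | swap =>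
    intro s f hf
    exact hF.tau_mem _ hf

theorem mem_of_hasOp (hF : IsSPreclone F) {sgn : ι → S} {fn : (ι → A) → A}
    (h : HasOp F sgn fn) {n : ℕ} (e : Fin (n + 1) ≃ ι) :
    (⟨n, sgn ∘ e, fun x => fn (x ∘ e.symm)⟩ : SOp S A) ∈ F := by
  obtain ⟨m, e', h⟩ := h
  obtain rfl : m = n := by
    have := Fin.equiv_iff_eq.1 ⟨e'.trans e.symm⟩
    omega
  convert! hF.perm_mem (e.trans e'.symm) _ _ h using 2
  · ext i; simp
  · ext x; simp [Function.comp_def]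

theorem hasOp_option (hF : IsSPreclone F) {sgn : Option ι → S} {fn : (ι → A) → A}
    (h : HasOp F (sgn ∘ some) fn) : HasOp F sgn (fun x => fn (x ∘ some)) := by
  obtain ⟨n, e, h⟩ := h
  refine ⟨n + 1, (finSuccEquiv (n + 1)).trans e.optionCongr, ?_⟩
  convert! hF.nabla_mem (sgn none) _ h using 1
  refine SOp.ext rfl (heq_of_eq ?_) (heq_of_eq ?_)
  · ext i
    refine Fin.cases ?_ (fun i => ?_) i <;> simp [SOp.nabla]
  · ext x
    simp [SOp.nabla, Function.comp_def, Fin.tail, Equiv.optionCongr_symm_some]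

theorem hasOp_identify (hF : IsSPreclone F) {sgn : Option ι → S} {fn : (Option ι → A) → A}
    (h : HasOp F sgn fn) (i₀ : ι) (hs : sgn none = sgn (some i₀)) :
    HasOp F (sgn ∘ some) (fun x => fn (fun o => o.elim (x i₀) x)) := by
  have : Finite ι := by
    obtain ⟨n, e, h⟩ := h
    have := Finite.of_equiv _ e
    exact Finite.of_injective (some : ι → Option ι) (Option.some_injective _)
  have : Nonempty ι := ⟨i₀⟩
  obtain ⟨m, ⟨e₀⟩⟩ := exists_finSuccEquiv ι
  -- `delta` merges the first two places only: `none` occupies the first, so `i₀` is put second.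
  obtain ⟨e, he⟩ : ∃ e : Fin (m + 1) ≃ ι, e 0 = i₀ :=
    ⟨(Equiv.swap 0 (e₀.symm i₀)).trans e₀, by simp⟩
  have hmem := hF.mem_of_hasOp h ((finSuccEquiv (m + 1)).trans e.optionCongr)
  refine ⟨m, e, ?_⟩
  have hd := hF.delta_mem _ hmem
  have h1 : (finSuccEquiv (m + 1)) 1 = some 0 := finSuccEquiv_succ 0
  rw [SOp.delta, if_pos (by simp [h1, he, hs])] at hd
  convert! hd using 2
  · ext x
    refine congrArg fn (funext fun o => ?_)
    rcases o with _ | i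
    · simp [← he, Equiv.optionCongr_symm_none]
    · simp [Equiv.optionCongr_symm_some]

theorem hasOp_sum (hF : IsSPreclone F) (τ : Type) [Finite τ] {sgn : τ ⊕ ι → S}
    {fn : (ι → A) → A} (h : HasOp F (sgn ∘ Sum.inr) fn) :
    HasOp F sgn (fun x => fn (x ∘ Sum.inr)) := by
  induction τ using Finite.induction_empty_option with
  | of_equiv e ih =>
    exact hasOp_equiv (ih (sgn := sgn ∘ Sum.map e id) h)
      (e.sumCongr (Equiv.refl ι)) (fun i => by cases i <;> rfl)
  | h_empty => exact hasOp_equiv h (Equiv.emptySum PEmpty ι).symm (fun i => rfl)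
  | h_option ih =>
    rename_i τ _
    let e : Option (τ ⊕ ι) ≃ Option τ ⊕ ι :=
      ⟨fun o => o.elim (Sum.inl none) (Sum.map some id),
        Sum.elim (fun o => o.elim none (some ∘ Sum.inl)) (some ∘ Sum.inr),
        by rintro (_ | _ | _) <;> rfl, by rintro ((_ | _) | _) <;> rfl⟩
    exact hasOp_equiv (hF.hasOp_option (sgn := sgn ∘ e) (ih (sgn := sgn ∘ e ∘ some) h)) e
      (fun i => rfl)

theorem hasOp_sum_identify (hF : IsSPreclone F) (τ : Type) [Finite τ] {sgn : τ ⊕ ι → S}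
    {fn : (τ ⊕ ι → A) → A} (h : HasOp F sgn fn) (σ : τ → ι)
    (hs : ∀ t, sgn (Sum.inl t) = sgn (Sum.inr (σ t))) :
    HasOp F (sgn ∘ Sum.inr) (fun x => fn (Sum.elim (x ∘ σ) x)) := by
  induction τ using Finite.induction_empty_option with
  | @of_equiv α β e ih =>
    refine cast ?_ (ih (hasOp_equiv h (e.symm.sumCongr (Equiv.refl ι))
      (sgn' := sgn ∘ Sum.map e id) (fun i => by cases i <;> simp)) (σ ∘ e) (fun t => hs (e t)))
    congr 1
    funext x
    congr 1
    funext i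
    rcases i with i | i <;> simp
  | h_empty =>
    refine cast ?_ (hasOp_equiv h (Equiv.emptySum PEmpty ι) (sgn' := sgn ∘ Sum.inr)
      (fun i => by rcases i with i | i; exacts [i.elim, rfl]))
    congr 1
    funext x
    congr 1
    funext i
    rcases i with i | i
    exacts [i.elim, rfl]
  | @h_option τ _ ih =>
    let e : Option τ ⊕ ι ≃ Option (τ ⊕ ι) :=
      ⟨Sum.elim (fun o => o.elim none (some ∘ Sum.inl)) (some ∘ Sum.inr),
        fun o => o.elim (Sum.inl none) (Sum.map some id),
        by rintro ((_ | _) | _) <;> rfl, by rintro (_ | _ | _) <;> rfl⟩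
    have h1 := hasOp_equiv h e (sgn' := sgn ∘ e.symm) (fun i => by simp)
    have h2 := hF.hasOp_identify h1 (Sum.inr (σ none)) (hs none)
    refine cast ?_ (ih h2 (σ ∘ some) (fun t => hs (some t)))
    congr 1
    funext x
    congr 1
    funext i
    rcases i with (_ | i) | i <;> rfl

/-- Append the variables `κ` as fictitious arguments, then identify each old argument `i` with `σ
i`, which carries the same label. -/
theorem hasOp_minor (hF : IsSPreclone F) {sgn : ι → S} {fn : (ι → A) → A} (h : HasOp F sgn fn)
    [Finite κ] (σ : ι → κ) {sgn' : κ → S} (hs : ∀ i, sgn' (σ i) = sgn i) :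
    HasOp F sgn' (fun x => fn (x ∘ σ)) := by
  obtain ⟨n, e, h⟩ := h
  obtain ⟨m, ⟨d⟩⟩ := Finite.exists_equiv_fin κ
  have h1 : HasOp F (sgn ∘ e) (fun x => fn (x ∘ e.symm)) := ⟨n, Equiv.refl _, h⟩
  have h2 := hF.hasOp_sum (Fin m) (sgn := Sum.elim (sgn' ∘ d.symm) (sgn ∘ e)) h1
  have h3 := hasOp_equiv h2 ((Equiv.sumComm _ _).trans ((Equiv.refl _).sumCongr d.symm))
    (sgn' := Sum.elim (sgn ∘ e) sgn') (by rintro (i | i) <;> simp)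
  have h4 := hF.hasOp_sum_identify _ h3 (σ ∘ e) (by simp [hs])
  refine cast ?_ h4
  congr 1
  funext x
  congr 1
  funext i
  simp

theorem hasOp_comp (hF : IsSPreclone F) {sf : Option ι → S} {f : (Option ι → A) → A}
    (hf : HasOp F sf f) {sg : κ → S} {g : (κ → A) → A} (hg : HasOp F sg g) :
    HasOp F (Sum.elim (fun k => sg k * sf none) (sf ∘ some))
      (fun x => f (fun o => o.elim (g (x ∘ Sum.inl)) (x ∘ Sum.inr))) := by
  have : Finite ι := by
    obtain ⟨n, e, h⟩ := hf
    have := Finite.of_equiv _ e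
    exact Finite.of_injective (some : ι → Option ι) (Option.some_injective _)
  obtain ⟨n, ⟨d⟩⟩ := Finite.exists_equiv_fin ι
  obtain ⟨m, e, hg⟩ := hg
  have hf := hF.mem_of_hasOp hf ((finSuccEquiv n).trans d.symm.optionCongr)
  have hsum : m + n + 1 = (m + 1) + n := by omega
  refine ⟨m + n, (finCongr hsum).trans (finSumFinEquiv.symm.trans (e.sumCongr d.symm)), ?_⟩
  convert! hF.comp_mem _ hf _ hg using 1
  refine SOp.ext rfl (heq_of_eq ?_) (heq_of_eq ?_)
  · funext i
    obtain ⟨j, rfl⟩ := (finCongr hsum).symm.surjective i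
    refine Fin.addCases (fun j => ?_) (fun j => ?_) j
    · have h1 : (j : ℕ) ≤ m := by omega
      simp [SOp.comp, Equiv.optionCongr_symm_none, h1]
    · have h1 : ∀ h : m + 1 + (j : ℕ) - m < n + 1, (⟨m + 1 + j - m, h⟩ : Fin (n + 1)) = j.succ := by
        intro h; ext; simp; omega
      have h2 : ¬ m + 1 + (j : ℕ) ≤ m := by omega
      simp [SOp.comp, h1, h2, Equiv.optionCongr_symm_some]
  · funext x
    simp only [SOp.comp]
    congr 1
    funext o
    rcases o with _ | i
    · simp [Function.comp_def]
      rfl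
    · simp [Function.comp_def]
      rfl

end IsSPreclone

end IndexedOperations

/-! ### Functional completeness and generation of the full preclone. -/

section Generation

theorem webb_succ {K : ℕ} (x y : Fin (K + 1)) : webb (K + 1) x y = max x y + 1 := by
  ext
  have : ((max x y : Fin (K + 1)) : ℕ) = max (x : ℕ) (y : ℕ) := Fin.coe_max x y
  simp [webb, Fin.val_add, this]

/-- Functional completeness of Webb's function, in Stone–Weierstrass form. -/
theorem eq_univ_of_webb_mem {k : ℕ} {X : Type*} [Finite X] {C : Set (X → Fin k)}
    (hne : C.Nonempty) (hw : ∀ f ∈ C, ∀ g ∈ C, (fun x => webb k (f x) (g x)) ∈ C)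
    (hsep : ∀ x y, x ≠ y → ∃ f ∈ C, f x ≠ f y) : C = Set.univ := by
  classical
  have := Fintype.ofFinite X
  refine Set.eq_univ_of_forall fun F => ?_
  obtain ⟨f₀, hf₀⟩ := hne
  by_cases hk : k ≤ 1
  · have : Subsingleton (Fin k) := Fin.subsingleton_iff_le_one.2 hk
    rwa [Subsingleton.elim F f₀]
  obtain ⟨K, rfl⟩ : ∃ K, k = K + 2 := ⟨k - 2, by omega⟩
  simp only [webb_succ] at hw
  -- Webb's function of `f` with itself is `f + 1`; iterate.
  have hadd : ∀ f ∈ C, ∀ c : Fin (K + 2), (fun x => f x + c) ∈ C := by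
    intro f hf c
    induction c using Fin.induction with
    | zero => simpa using hf
    | succ i ih => simpa [add_assoc, Fin.coeSucc_eq_succ] using hw _ ih _ ih
  have hsup : ∀ f ∈ C, ∀ g ∈ C, f ⊔ g ∈ C := fun f hf g hg => by
    convert! hadd _ (hw f hf g hg) (-1) using 1
    ext x; simp
  have hmax : ∀ a : Fin (K + 2), a ≤ Fin.last _ := Fin.le_last
  have hle : ∀ a : Fin (K + 2), a ≠ Fin.last _ → a ≤ (Fin.last K).castSucc := fun a ha => by
    have h1 := Fin.val_lt_last ha
    rw [Fin.le_def]
    simp at h1 ⊢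
    omega
  -- At each point some shift of `f₀` reaches the top, so the supremum of all shifts is constant.
  have hlast : (fun _ => Fin.last (K + 1)) ∈ C := by
    have h : Finset.univ.sup' Finset.univ_nonempty (fun c x => f₀ x + c) ∈ C :=
      Finset.sup'_induction _ _ hsup fun c _ => hadd f₀ hf₀ c
    convert! h using 1
    ext1 x
    refine le_antisymm ?_ (hmax _)
    rw [Finset.sup'_apply]
    refine le_trans (le_of_eq ?_)
      (Finset.le_sup' (fun c => f₀ x + c) (Finset.mem_univ (Fin.last (K + 1) - f₀ x)))
    simp
  have hconst : ∀ c : Fin (K + 2), (fun _ => c) ∈ C := fun c => by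
    simpa using hadd _ hlast (c - Fin.last (K + 1))
  have hone : Fin.last (K + 1) + 1 = 0 := Fin.last_add_one _
  have hJ : ∀ f ∈ C, ∀ a : Fin (K + 2), (fun x => if f x = a then Fin.last _ else 0) ∈ C := by
    intro f hf a
    -- Omit the one shift taking `a` to the top: the supremum of the others is the top minus one
    -- where `f x = a` and the top elsewhere. Adding `1` gives the indicator.
    have hT : (Finset.univ.erase (Fin.last (K + 1) - a)).Nonempty :=
      (Finset.univ_nontrivial).erase_nonempty
    have h : (Finset.univ.erase (Fin.last (K + 1) - a)).sup' hT (fun c x => f x + c) ∈ C :=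
      Finset.sup'_induction _ _ hsup fun c _ => hadd f hf c
    convert! hadd _ h 1 using 1
    ext1 x
    rw [Finset.sup'_apply]
    split_ifs with hx
    · rw [← sub_eq_iff_eq_add]
      apply le_antisymm
      · refine le_trans (le_of_eq ?_)
          (Finset.le_sup' (fun c => f x + c) (b := Fin.last (K + 1) - 1 - a) ?_)
        · rw [hx]; abel
        · simp
      · refine Finset.sup'_le _ _ fun c hc => ?_
        have hne : f x + c ≠ Fin.last (K + 1) := fun h => by
          apply Finset.ne_of_mem_erase hc
          rw [← h, hx]; abel
        have h1 : Fin.last (K + 1) - 1 = (Fin.last K).castSucc := by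
          rw [sub_eq_iff_eq_add]; ext; simp
        rw [h1]
        exact hle _ hne
    · rw [eq_comm, ← hone, add_left_inj]
      refine le_antisymm (hmax _) (le_trans (le_of_eq ?_)
          (Finset.le_sup' (fun c => f x + c) (b := Fin.last (K + 1) - f x) ?_))
      · abel
      · simpa using hx
  have hcomp : ∀ f ∈ C, ∀ ψ : Fin (K + 2) → Fin (K + 2), (fun x => ψ (f x)) ∈ C := by
    intro f hf ψ
    have hi : ∀ a b : Fin (K + 2), (fun x => if f x = a then b else 0) ∈ C := fun a b => by
      -- The supremum is the top or the top minus `b`; adding `b + 1` cyclically sends these to `b`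
      -- and `0`.
      convert! hadd _ (hsup _ (hJ f hf a) _ (hconst (Fin.last (K + 1) - b))) (b + 1) using 1
      ext1 x
      simp only [Pi.sup_apply]
      split_ifs
      · rw [sup_of_le_left (hmax _), add_left_comm, hone, add_zero]
      · rw [sup_of_le_right (Fin.zero_le _), ← add_assoc, sub_add_cancel, hone]
    have h : Finset.univ.sup (fun a x => if f x = a then ψ a else 0) ∈ C :=
      Finset.sup_induction (hconst 0) hsup fun a _ => hi a (ψ a)
    convert! h using 1
    ext1 x
    rw [Finset.sup_apply]
    apply le_antisymm
    · refine le_trans (le_of_eq ?_) (Finset.le_sup (Finset.mem_univ (f x)))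
      simp
    · refine Finset.sup_le fun a _ => ?_
      split_ifs with h
      · rw [h]
      · exact Fin.zero_le _
  have hpoint : ∀ x₀ b, (fun x => if x = x₀ then b else 0) ∈ C := by
    intro x₀ b
    have : ∀ y, ∃ f ∈ C, y ≠ x₀ → f y ≠ f x₀ := fun y => by
      by_cases hy : y = x₀
      · exact ⟨f₀, hf₀, fun h => (h hy).elim⟩
      · obtain ⟨f, hf, h⟩ := hsep y x₀ hy
        exact ⟨f, hf, fun _ => h⟩
    choose f hf hfy using this
    -- This function vanishes at `x₀` only, because `f y` separates `y` from `x₀`.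
    have h : Finset.univ.sup (fun y x => if f y x = f y x₀ then 0 else Fin.last (K + 1)) ∈ C :=
      Finset.sup_induction (hconst 0) hsup fun y _ =>
        hcomp _ (hf y) (fun c => if c = f y x₀ then 0 else Fin.last (K + 1))
    convert! hcomp _ h (fun c => if c = 0 then b else 0) using 1
    ext1 x
    rw [Finset.sup_apply]
    refine if_congr ⟨?_, fun h0 => ?_⟩ rfl rfl
    · rintro rfl
      exact le_antisymm (Finset.sup_le fun y _ => by simp) (Fin.zero_le _)
    · by_contra hx
      have h1 := Finset.le_sup (f := fun y => if f y x = f y x₀ then 0 else Fin.last (K + 1))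
        (Finset.mem_univ x)
      rw [h0, if_neg (hfy x hx)] at h1
      simp at h1
  have h : Finset.univ.sup (fun y x => if x = y then F y else 0) ∈ C :=
    Finset.sup_induction (hconst 0) hsup fun y _ => hpoint y (F y)
  convert! h using 1
  ext1 x
  rw [Finset.sup_apply]
  apply le_antisymm
  · refine le_trans (le_of_eq ?_) (Finset.le_sup (Finset.mem_univ x))
    simp
  · refine Finset.sup_le fun a _ => ?_
    split_ifs with h
    · rw [h]
    · exact Fin.zero_le _

variable {S : Type u} {A : Type v} {ι κ : Type*} [Monoid S] {F : Set (SOp S A)}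

namespace IsSPreclone

theorem hasOp_proj (hF : IsSPreclone F) [Finite ι] {sgn : ι → S} {i : ι} (hi : sgn i = 1) :
    HasOp F sgn (fun x => x i) :=
  hF.hasOp_minor (hasOp_of_mem hF.id_mem) (fun _ => i) (fun _ => hi)

theorem hasOp_binary (hF : IsSPreclone F) {m : A → A → A} (hm : SOp.binary 1 1 m ∈ F)
    {g h : (κ → A) → A} (hg : HasOp F (fun _ => 1) g) (hh : HasOp F (fun _ => 1) h) :
    HasOp F (fun _ : κ => (1 : S)) (fun x => m (g x) (h x)) := by
  have : Finite κ := by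
    obtain ⟨n, e, h⟩ := hg
    exact Finite.of_equiv _ e
  have h1 : HasOp F (fun _ : Option Unit => (1 : S)) (fun x => m (x none) (x (some ()))) :=
    hF.hasOp_minor (hasOp_of_mem hm) (fun i : Fin 2 => if i = 0 then none else some ())
      (fun i : Fin 2 => by fin_cases i <;> rfl)
  have h2 := hF.hasOp_comp h1 hg
  have h3 : HasOp F (fun _ : Option κ => (1 : S))
      (fun x => m (g (fun i => x (some i))) (x none)) :=
    hF.hasOp_minor h2 (Sum.elim some fun _ => none) (by rintro (_ | _) <;> simp)
  have h4 := hF.hasOp_comp h3 hh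
  exact hF.hasOp_minor h4 (Sum.elim id id) (by rintro (_ | _) <;> simp)

/-- Substituting `id^s` into an argument labelled `1` leaves the function unchanged and makes the
label `s * 1 = s`. -/
theorem hasOp_update (hF : IsSPreclone F) [DecidableEq ι] {sgn : ι → S} {fn : (ι → A) → A}
    (h : HasOp F sgn fn) {i₀ : ι} (hi : sgn i₀ = 1) {s : S} (hs : SOp.idOp A s ∈ F) :
    HasOp F (Function.update sgn i₀ s) fn := by
  have : Finite ι := by
    obtain ⟨n, e, h⟩ := h
    exact Finite.of_equiv _ e
  have h1 : HasOp F (fun o => o.elim 1 fun i : {i // i ≠ i₀} => sgn i)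
      (fun x => fn (x ∘ (Equiv.optionSubtypeNe i₀).symm)) :=
    hF.hasOp_minor h _ (fun i => by
      by_cases h : i = i₀
      · subst h; simp [hi]
      · simp [Equiv.optionSubtypeNe_symm_of_ne h])
  have h2 := hF.hasOp_comp h1 (hasOp_of_mem hs)
  refine cast ?_ (hF.hasOp_minor h2 (sgn' := Function.update sgn i₀ s)
    (Sum.elim (fun _ => i₀) Subtype.val) ?_)
  · congr 1
    funext x
    congr 1
    funext i
    by_cases h : i = i₀
    · subst h; simp [SOp.idOp]
    · simp [Equiv.optionSubtypeNe_symm_of_ne h]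
  · rintro (_ | ⟨i, hi⟩)
    · change Function.update sgn i₀ s i₀ = s * 1
      simp
    · simp [hi]

theorem hasOp_relabel (hF : IsSPreclone F) [Finite ι] (hid : ∀ s, SOp.idOp A s ∈ F)
    {fn : (ι → A) → A} (h : HasOp F (fun _ => 1) fn) (sgn : ι → S) : HasOp F sgn fn := by
  classical
  have := Fintype.ofFinite ι
  suffices H : ∀ T : Finset ι, HasOp F (fun i => if i ∈ T then sgn i else 1) fn by
    simpa using H Finset.univ
  intro T
  induction T using Finset.induction_on with
  | empty => simpa using h
  | insert i T hi ih =>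
    refine cast ?_ (hF.hasOp_update ih (i₀ := i) (by simp [hi]) (hid (sgn i)))
    congr 1
    funext j
    by_cases hj : j = i
    · subst hj; simp
    · simp [hj]

/-- An `S`-preclone containing Webb's function and all labelled identities is full. -/
theorem eq_univ_of_webb (hF : IsSPreclone F) {k : ℕ} (e : A ≃ Fin k)
    (hm : SOp.binary 1 1 (fun x y => e.symm (webb k (e x) (e y))) ∈ F)
    (hid : ∀ s, SOp.idOp A s ∈ F) : F = Set.univ := by
  have : Finite A := Finite.of_equiv _ e.symm
  refine Set.eq_univ_of_forall fun ⟨n, sgn, fn⟩ => ?_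
  have key := eq_univ_of_webb_mem
    (C := {f : (Fin (n + 1) → A) → Fin k | HasOp F (fun _ => (1 : S)) (fun x => e.symm (f x))})
    ⟨fun x => e (x 0), by
      simpa using! hF.hasOp_proj (ι := Fin (n + 1)) (sgn := fun _ => 1) (i := 0) rfl⟩
    (fun f hf g hg => by
      simpa using! hF.hasOp_binary hm (g := fun x => e.symm (f x)) (h := fun x => e.symm (g x))
        hf hg)
    (fun x y hxy => by
      obtain ⟨i, hi⟩ := Function.ne_iff.1 hxy
      refine ⟨fun x => e (x i), ?_, e.injective.ne hi⟩
      simpa using! hF.hasOp_proj (ι := Fin (n + 1)) (sgn := fun _ => 1) (i := i) rfl)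
  have h1 : HasOp F (fun _ : Fin (n + 1) => (1 : S)) fn := by
    have := Set.eq_univ_iff_forall.1 key (fun x => e (fn x))
    simpa using! this
  exact hF.mem_of_hasOp (hF.hasOp_relabel hid h1 sgn) (Equiv.refl _)

end IsSPreclone

theorem isSPreclone_closure (F : Set (SOp S A)) : IsSPreclone (precloneClosure F) :=
  IsSPreclone.sInter fun _ hP => hP.1

theorem subset_precloneClosure (F : Set (SOp S A)) : F ⊆ precloneClosure F :=
  Set.subset_sInter fun _ hP => hP.2

theorem precloneClosure_subset {F P : Set (SOp S A)} (hP : IsSPreclone P) (h : F ⊆ P) :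
    precloneClosure F ⊆ P :=
  Set.sInter_subset_of_mem ⟨hP, h⟩

theorem precloneClosure_webb {k : ℕ} (e : A ≃ Fin k) :
    precloneClosure
      (({SOp.binary (1 : S) 1 (fun x y => e.symm (webb k (e x) (e y)))} : Set (SOp S A)) ∪
        Set.range (fun s : S => SOp.idOp A s)) = Set.univ :=
  (isSPreclone_closure _).eq_univ_of_webb e (subset_precloneClosure _ (Or.inl rfl))
    fun s => subset_precloneClosure _ (Or.inr ⟨s, rfl⟩)

theorem exists_finite_precloneClosure_eq_univ [Finite S] [Finite A] :
    ∃ F : Set (SOp S A), F.Finite ∧ precloneClosure F = Set.univ := by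
  obtain ⟨k, ⟨e⟩⟩ := Finite.exists_equiv_fin A
  exact ⟨_, (Set.finite_singleton _).union (Set.finite_range _), precloneClosure_webb e⟩

end Generation

/-! ### Characterisations of projections through ultrafilters. -/

section Relations

theorem exists_forall_mem_iff_of_ultrafilter {I : Type*} [Finite I] {W : Set (Set I)}
    (up : ∀ U ∈ W, ∀ V, U ⊆ V → V ∈ W) (inter : ∀ U ∈ W, ∀ V ∈ W, U ∩ V ∈ W)
    (compl : ∀ U, Uᶜ ∉ W ↔ U ∈ W) : ∃ j, ∀ U, U ∈ W ↔ j ∈ U := by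
  have hempty : ∅ ∉ W := fun h => (compl Set.univ).2 (up _ h _ (Set.empty_subset _)) (by simpa)
  let G : Filter I :=
    ⟨W, (compl _).1 (by simpa), fun {U V} hU h => up U hU V h, fun {U V} hU hV => inter U hU V hV⟩
  obtain ⟨j, hj⟩ := (Ultrafilter.ofComplNotMemIff G compl).eq_pure_of_finite
  refine ⟨j, fun U => ?_⟩
  have h : U ∈ Ultrafilter.ofComplNotMemIff G compl ↔ j ∈ U := by rw [hj]; rfl
  exact h

/-- An operation which on any three arguments agrees with some projection to a coordinate in `E` is
itself such a projection. -/
theorem exists_eq_proj_of_forall_three {I A : Type*} [Finite I] {f : (I → A) → A} {E : Set I}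
    (hE : E.Nonempty) (h : ∀ x y z, ∃ i ∈ E, x i = f x ∧ y i = f y ∧ z i = f z) :
    ∃ j ∈ E, ∀ x, f x = x j := by
  classical
  rcases subsingleton_or_nontrivial A with hA | hA
  · obtain ⟨j, hj⟩ := hE
    exact ⟨j, hj, fun x => Subsingleton.elim _ _⟩
  obtain ⟨a, b, hab⟩ := exists_pair_ne A
  let χ : Set I → I → A := fun U i => if i ∈ U then a else b
  have hχ : ∀ U i, χ U i = a ↔ i ∈ U := fun U i => by
    by_cases hi : i ∈ U <;> simp [χ, hi, hab.symm]
  -- Each ultrafilter axiom involves at most three sets, so agreement with a projection on three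
  -- arguments is enough to verify it.
  let W : Set (Set I) := {U | f (χ U) = a}
  have hW : ∀ x U V, ∃ i ∈ E, x i = f x ∧ (i ∈ U ↔ U ∈ W) ∧ (i ∈ V ↔ V ∈ W) := by
    intro x U V
    obtain ⟨i, hi, h1, h2, h3⟩ := h x (χ U) (χ V)
    exact ⟨i, hi, h1, by rw [← hχ, h2]; rfl, by rw [← hχ, h3]; rfl⟩
  obtain ⟨j, hj⟩ := exists_forall_mem_iff_of_ultrafilter (W := W)
    (fun U hU V hUV => by
      obtain ⟨i, -, -, h1, h2⟩ := hW (χ U) U V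
      exact h2.1 (hUV (h1.2 hU)))
    (fun U hU V hV => by
      obtain ⟨i, -, h1, h2, h3⟩ := hW (χ U) V (U ∩ V)
      exact h3.1 ⟨(hχ U i).1 (h1.trans hU), h2.2 hV⟩)
    (fun U => by
      obtain ⟨i, -, -, h1, h2⟩ := hW (χ U) U Uᶜ
      rw [← h1, ← h2, Set.notMem_compl_iff])
  refine ⟨j, ?_, fun x => ?_⟩
  · obtain ⟨i, hi, -, h1, -⟩ := hW (χ E) E E
    exact (hj E).1 (h1.1 hi)
  · obtain ⟨i, -, h1, h2, -⟩ := hW x {i | x i = f x} ∅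
    exact ((hj _).1 (h2.1 h1)).symm

/-- On a chain with at least three elements, the only operations preserving both the order and
inequality are the projections. -/
theorem exists_eq_proj_of_preserves_le_ne {I : Type*} [Finite I] {k : ℕ} (hk : 3 ≤ k)
    {f : (I → Fin k) → Fin k} (hle : ∀ x y, (∀ i, x i ≤ y i) → f x ≤ f y)
    (hne : ∀ x y, (∀ i, x i ≠ y i) → f x ≠ f y) : ∃ j, ∀ x, f x = x j := by
  classical
  -- The diagonal is injective and monotone, and a finite chain has no order automorphism but the
  -- identity.
  have hdiag : ∀ c, f (fun _ => c) = c := by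
    let g : Fin k → Fin k := fun c => f fun _ => c
    have hinj : Function.Injective g := fun c d h => by
      by_contra hcd
      exact hne _ _ (fun _ => hcd) h
    have hmono : StrictMono g :=
      (show Monotone g from fun c d h => hle _ _ fun _ => h).strictMono_of_injective hinj
    have h := Subsingleton.elim
      (hmono.orderIsoOfSurjective g (Finite.surjective_of_injective hinj)) (OrderIso.refl (Fin k))
    exact fun c => DFunLike.congr_fun h c
  have hcons : ∀ x, ∃ i, x i = f x := fun x => by
    by_contra! h
    exact hne x (fun _ => f x) h (hdiag _).symm
  let χ : Fin k → Fin k → Set I → I → Fin k := fun a b U i => if i ∈ U then a else b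
  have hχ : ∀ a b U, f (χ a b U) = a ∨ f (χ a b U) = b := fun a b U => by
    obtain ⟨i, hi⟩ := hcons (χ a b U)
    rw [← hi]
    exact ite_eq_or_eq _ _ _
  -- The two tuples differ everywhere, so they cannot both have value `b`.
  have hstep : ∀ a b c U, a ≠ b → b ≠ c → f (χ b c U) = b → f (χ a b U) = a := by
    intro a b c U hab hbc h
    refine (hχ a b U).resolve_right fun h' => hne (χ a b U) (χ b c U) (fun i => ?_) (h'.trans h.symm)
    by_cases hi : i ∈ U <;> simp [χ, hi, hab, hbc]
  obtain ⟨p, q, r, hpq, hqr⟩ : ∃ p q r : Fin k, p < q ∧ q < r :=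
    ⟨⟨0, by omega⟩, ⟨1, by omega⟩, ⟨2, by omega⟩, by simp, by simp⟩
  have hpr := hpq.trans hqr
  let W : Set (Set I) := {U | f (χ p q U) = p}
  have hflip : ∀ U, U ∈ W ↔ f (χ q p U) = q := fun U =>
    ⟨hstep q p q U hpq.ne' hpq.ne, hstep p q p U hpq.ne hpq.ne'⟩
  have hup : ∀ U ∈ W, ∀ V, U ⊆ V → V ∈ W := by
    intro U hU V hUV
    rw [hflip] at hU ⊢
    refine (hχ q p V).resolve_right fun h => ?_
    have : f (χ q p U) ≤ f (χ q p V) := hle _ _ fun i => by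
      by_cases h1 : i ∈ U
      · simp [χ, h1, hUV h1]
      · by_cases h2 : i ∈ V <;> simp [χ, h1, h2, hpq.le]
    rw [hU, h] at this
    exact hpq.not_ge this
  have hcompl : ∀ U, Uᶜ ∉ W ↔ U ∈ W := by
    intro U
    have : χ p q Uᶜ = χ q p U := by
      ext1 i
      by_cases h : i ∈ U <;> simp [χ, h]
    rw [hflip U]
    change ¬ f (χ p q Uᶜ) = p ↔ _
    rw [this]
    exact ⟨(hχ q p U).resolve_right, fun h => h.trans_ne hpq.ne'⟩
  have hmem : ∀ x, {i | x i = f x} ∈ W := by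
    intro x
    have key : ∀ b, b ≠ f x → f (χ b (f x) {i | x i = f x}) = b := fun b hb => by
      refine (hχ _ _ _).resolve_right fun h => hne _ x (fun i => ?_) h
      by_cases hi : x i = f x
      · simp [χ, hi, hb]
      · simp [χ, hi, Ne.symm hi]
    by_cases hq : f x = q
    · have := key p (hq ▸ hpq.ne)
      rw [hq] at this ⊢
      exact this
    by_cases hp : f x = p
    · have := key q (hp ▸ hpq.ne')
      rw [hp] at this ⊢
      exact (hflip _).2 this
    · exact (hflip _).2 (hstep q p _ _ hpq.ne' (Ne.symm hp) (key p (Ne.symm hp)))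
  have hinter : ∀ U ∈ W, ∀ V ∈ W, U ∩ V ∈ W := by
    intro U hU V hV
    -- The three values of `x` distinguish `U ∩ V`, `U \ V` and `Uᶜ`. The level set of the value `f
    -- x` lies in `W`; the last two alternatives would put `Vᶜ` or `Uᶜ` into `W`.
    let x : I → Fin k := fun i => if i ∈ U then if i ∈ V then p else q else r
    obtain ⟨i, hi⟩ := hcons x
    have hx := hmem x
    rw [← hi] at hx
    have hxp : ∀ l, x l = p → l ∈ U ∩ V := fun l hl => by
      by_cases h1 : l ∈ U
      · by_cases h2 : l ∈ V
        · exact ⟨h1, h2⟩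
        · simp [x, h1, h2, hpq.ne'] at hl
      · simp [x, h1, hpr.ne'] at hl
    have hxq : ∀ l, x l = q → l ∈ Vᶜ := fun l hl h2 => by
      by_cases h1 : l ∈ U
      · simp [x, h1, h2, hpq.ne] at hl
      · simp [x, h1, hqr.ne'] at hl
    have hxr : ∀ l, x l = r → l ∈ Uᶜ := fun l hl h1 => by
      by_cases h2 : l ∈ V
      · simp [x, h1, h2, hpr.ne] at hl
      · simp [x, h1, h2, hqr.ne] at hl
    by_cases h1 : i ∈ U
    · by_cases h2 : i ∈ V
      · exact hup _ hx _ fun l hl => hxp l (hl.trans (by simp [x, h1, h2]))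
      · exact ((hcompl V).2 hV
          (hup _ hx _ fun l hl => hxq l (hl.trans (by simp [x, h1, h2])))).elim
    · exact ((hcompl U).2 hU
        (hup _ hx _ fun l hl => hxr l (hl.trans (by simp [x, h1])))).elim
  obtain ⟨j, hj⟩ := exists_forall_mem_iff_of_ultrafilter hup hinter hcompl
  exact ⟨j, fun x => ((hj _).1 (hmem x)).symm⟩

/-! ### Primitive positive definitions in relational clones. -/

variable {S : Type u} {A : Type v} {ι κ : Type*}

/-- The `S`-relation whose rows are indexed by `ι` (of positive finite cardinality) belongs to `C`
for some enumeration of `ι`. -/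
def HasRel (C : Set (SRel S A)) (r : S → Set (ι → A)) : Prop :=
  ∃ (n : ℕ) (e : Fin (n + 1) ≃ ι), (⟨n, fun s => {a | a ∘ e.symm ∈ r s}⟩ : SRel S A) ∈ C

theorem hasRel_of_mem {C : Set (SRel S A)} {ρ : SRel S A} (h : ρ ∈ C) : HasRel C ρ.rel :=
  ⟨ρ.pred, Equiv.refl _, h⟩

namespace HasRel

variable {C : Set (SRel S A)}

theorem congr {r r' : S → Set (ι → A)} (h : HasRel C r) (h' : ∀ s x, x ∈ r s ↔ x ∈ r' s) :
    HasRel C r' := by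
  rwa [← show r = r' from funext fun s => Set.ext (h' s)]

theorem finite {r : S → Set (ι → A)} (h : HasRel C r) : Finite ι := by
  obtain ⟨n, e, -⟩ := h
  exact Finite.of_equiv _ e

theorem equiv {r : S → Set (ι → A)} (h : HasRel C r) (e : ι ≃ κ) :
    HasRel C (fun s => {x : κ → A | x ∘ e ∈ r s}) := by
  obtain ⟨n, e', h⟩ := h
  refine ⟨n, e'.trans e, ?_⟩
  have H : ∀ a : Fin (n + 1) → A, (a ∘ (e'.trans e).symm) ∘ e = a ∘ e'.symm := fun a => by
    ext i; simp
  simpa only [Set.mem_ofPred_eq, H] using h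

end HasRel

namespace IsSRelClone

variable [Monoid S] {C : Set (SRel S A)}

theorem perm_mem (hC : IsSRelClone C) {n : ℕ} (π : Equiv.Perm (Fin (n + 1))) :
    ∀ r : S → Set (Fin (n + 1) → A), (⟨n, r⟩ : SRel S A) ∈ C →
      (⟨n, fun s => {a | a ∘ π.symm ∈ r s}⟩ : SRel S A) ∈ C := by
  induction π using Equiv.Perm.induction_finRotate_swap with
  | one => exact fun _ h => h
  | mul π π' h h' => exact fun r hr => h' _ (h r hr)
  | rot =>
    intro r hr
    convert! hC.zeta_mem _ hr using 1
    refine SRel.ext rfl (heq_of_eq (funext fun s => Set.ext fun a => ?_))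
    constructor
    · intro h
      refine ⟨_, h, funext fun i => ?_⟩
      simp [-finRotate_apply]
    · rintro ⟨b, hb, rfl⟩
      refine Set.mem_of_eq_of_mem (s := r s) (funext fun i => ?_) hb
      simp [-finRotate_apply]
  | swap =>
    intro r hr
    convert! hC.tau_mem _ hr using 1
    refine SRel.ext rfl (heq_of_eq (funext fun s => Set.ext fun a => ?_))
    constructor
    · intro h
      refine ⟨_, h, funext fun i => ?_⟩
      simp
    · rintro ⟨b, hb, rfl⟩
      refine Set.mem_of_eq_of_mem (s := r s) (funext fun i => ?_) hb
      simp

theorem mem_of_hasRel (hC : IsSRelClone C) {r : S → Set (ι → A)} (h : HasRel C r) {n : ℕ}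
    (e : Fin (n + 1) ≃ ι) : (⟨n, fun s => {a | a ∘ e.symm ∈ r s}⟩ : SRel S A) ∈ C := by
  obtain ⟨m, e', h⟩ := h
  obtain rfl : m = n := by
    have := Fin.equiv_iff_eq.1 ⟨e'.trans e.symm⟩
    omega
  have H : ∀ a : Fin (m + 1) → A, (a ∘ (e.trans e'.symm).symm) ∘ e'.symm = a ∘ e.symm :=
    fun a => by ext i; simp
  simpa only [Set.mem_ofPred_eq, H] using hC.perm_mem (e.trans e'.symm) _ h

theorem hasRel_inter (hC : IsSRelClone C) {r r' : S → Set (ι → A)} (h : HasRel C r)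
    (h' : HasRel C r') : HasRel C (fun s => r s ∩ r' s) := by
  obtain ⟨n, e, h⟩ := h
  refine ⟨n, e, ?_⟩
  convert! hC.inter_mem _ h _ (hC.mem_of_hasRel h' e) using 1
  refine SRel.ext rfl (heq_of_eq (funext fun s => Set.ext fun a => ?_))
  simp [SRel.inter]

theorem hasRel_selfInter (hC : IsSRelClone C) {r : S → Set (ι → A)} (h : HasRel C r) (v : S) :
    HasRel C (fun s => {x | ∀ t, t * v = s → x ∈ r t}) := by
  obtain ⟨n, e, h⟩ := h
  exact ⟨n, e, hC.selfInter_mem v _ h⟩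

theorem hasRel_prod (hC : IsSRelClone C) {r : S → Set (ι → A)} {r' : S → Set (κ → A)}
    (h : HasRel C r) (h' : HasRel C r') :
    HasRel C (fun s => {x : ι ⊕ κ → A | x ∘ Sum.inl ∈ r s ∧ x ∘ Sum.inr ∈ r' s}) := by
  obtain ⟨n, e, h⟩ := h
  obtain ⟨m, d, h'⟩ := h'
  have hsum : n + m + 1 + 1 = (n + 1) + (m + 1) := by omega
  refine ⟨n + m + 1, (finCongr hsum).trans (finSumFinEquiv.symm.trans (e.sumCongr d)), ?_⟩
  convert! hC.prod_mem _ h _ h' using 1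

theorem hasRel_option_exists (hC : IsSRelClone C) [Nonempty ι] {r : S → Set (Option ι → A)}
    (h : HasRel C r) : HasRel C (fun s => {x | ∃ y ∈ r s, y ∘ some = x}) := by
  have : Finite ι := by
    have := h.finite
    exact Finite.of_injective (some : ι → Option ι) (Option.some_injective _)
  obtain ⟨n, ⟨e⟩⟩ := exists_finSuccEquiv ι
  refine ⟨n, e, ?_⟩
  convert! hC.pr_mem _ (hC.mem_of_hasRel h ((finSuccEquiv (n + 1)).trans e.optionCongr)) using 1
  refine SRel.ext rfl (heq_of_eq (funext fun s => Set.ext fun a => ?_))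
  constructor
  · rintro ⟨y, hy, h⟩
    refine ⟨y ∘ (finSuccEquiv (n + 1)).trans e.optionCongr, ?_, ?_⟩
    · refine Set.mem_of_eq_of_mem (s := r s) (funext fun i => ?_) hy
      simp
    · ext i
      simpa [Fin.tail] using congrFun h (e i)
  · rintro ⟨b, hb, rfl⟩
    refine ⟨_, hb, ?_⟩
    ext i
    simp [Fin.tail, Equiv.optionCongr_symm_some]

theorem hasRel_option_univ (hC : IsSRelClone C) {r : S → Set (ι → A)}
    (h : HasRel C r) : HasRel C (fun s => {x : Option ι → A | x ∘ some ∈ r s}) := by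
  have h1 : HasRel C (fun _ : S => (Set.univ : Set (Fin 1 → A))) := by
    refine HasRel.congr (hasRel_of_mem (hC.pr_mem _ hC.diag_mem)) fun s x => ?_
    simp only [Set.mem_univ, iff_true]
    exact ⟨fun _ => x 0, rfl, funext fun i => by rw [Subsingleton.elim (α := Fin 1) i 0]; rfl⟩
  let e : Fin 1 ⊕ ι ≃ Option ι :=
    ⟨Sum.elim (fun _ => none) some, fun o => o.elim (Sum.inl 0) Sum.inr,
      by rintro (i | _); exacts [congrArg Sum.inl (Subsingleton.elim (α := Fin 1) _ _), rfl],
      by rintro (_ | _) <;> rfl⟩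
  exact ((hC.hasRel_prod h1 h).equiv e).congr fun s x => by simp [e, Function.comp_def]

theorem hasRel_sum_univ (hC : IsSRelClone C) (τ : Type*) [Finite τ] {r : S → Set (ι → A)}
    (h : HasRel C r) : HasRel C (fun s => {x : τ ⊕ ι → A | x ∘ Sum.inr ∈ r s}) := by
  induction τ using Finite.induction_empty_option with
  | of_equiv e ih => exact ih.equiv (e.sumCongr (Equiv.refl ι))
  | h_empty => exact h.equiv (Equiv.emptySum PEmpty ι).symm
  | @h_option τ _ ih =>
    let e : Option (τ ⊕ ι) ≃ Option τ ⊕ ι :=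
      ⟨fun o => o.elim (Sum.inl none) (Sum.map some id),
        Sum.elim (fun o => o.elim none (some ∘ Sum.inl)) (some ∘ Sum.inr),
        by rintro (_ | _ | _) <;> rfl, by rintro ((_ | _) | _) <;> rfl⟩
    exact (hC.hasRel_option_univ ih).equiv e

theorem hasRel_sum_exists (hC : IsSRelClone C) (τ : Type*) [Finite τ] [Nonempty ι]
    {r : S → Set (τ ⊕ ι → A)} (h : HasRel C r) :
    HasRel C (fun s => {x | ∃ y ∈ r s, y ∘ Sum.inr = x}) := by
  induction τ using Finite.induction_empty_option with
  | of_equiv e ih =>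
    refine (ih (h.equiv (e.symm.sumCongr (Equiv.refl ι)))).congr fun s x => ⟨?_, ?_⟩
    · rintro ⟨y, hy, rfl⟩
      exact ⟨_, hy, rfl⟩
    · rintro ⟨y, hy, rfl⟩
      refine ⟨y ∘ e.sumCongr (Equiv.refl ι), ?_, rfl⟩
      refine Set.mem_of_eq_of_mem (s := r s) (funext fun i => ?_) hy
      rcases i with i | i <;> simp
  | h_empty =>
    refine (h.equiv (Equiv.emptySum PEmpty ι)).congr fun s x => ⟨fun hx => ⟨_, hx, rfl⟩, ?_⟩
    rintro ⟨y, hy, rfl⟩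
    refine Set.mem_of_eq_of_mem (s := r s) (funext fun i => ?_) hy
    rcases i with i | i
    exacts [i.elim, rfl]
  | @h_option τ _ ih =>
    let e : Option τ ⊕ ι ≃ Option (τ ⊕ ι) :=
      ⟨Sum.elim (fun o => o.elim none (some ∘ Sum.inl)) (some ∘ Sum.inr),
        fun o => o.elim (Sum.inl none) (Sum.map some id),
        by rintro ((_ | _) | _) <;> rfl, by rintro (_ | _ | _) <;> rfl⟩
    refine (ih (hC.hasRel_option_exists (h.equiv e))).congr fun s x => ⟨?_, ?_⟩
    · rintro ⟨_, ⟨y, hy, rfl⟩, rfl⟩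
      exact ⟨_, hy, rfl⟩
    · rintro ⟨y, hy, rfl⟩
      refine ⟨_, ⟨y ∘ e.symm, ?_, rfl⟩, rfl⟩
      simpa [Function.comp_assoc] using hy

theorem hasRel_comap_injective (hC : IsSRelClone C) [Finite κ] {r : S → Set (ι → A)}
    (h : HasRel C r) {j : ι → κ} (hj : Function.Injective j) :
    HasRel C (fun s => {x : κ → A | x ∘ j ∈ r s}) := by
  classical
  let e : ↑(Set.range j)ᶜ ⊕ ι ≃ κ :=
    (Equiv.sumComm _ _).trans
      (((Equiv.ofInjective j hj).sumCongr (Equiv.refl _)).trans (Equiv.Set.sumCompl _))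
  exact ((hC.hasRel_sum_univ _ h).equiv e).congr fun s x => by
    simp [e, Function.comp_def]

theorem hasRel_diag (hC : IsSRelClone C) :
    HasRel C (fun _ : S => {x : Fin 2 → A | x 0 = x 1}) :=
  hasRel_of_mem hC.diag_mem

theorem hasRel_univ (hC : IsSRelClone C) [Finite ι] [Nonempty ι] :
    HasRel C (fun _ : S => (Set.univ : Set (ι → A))) := by
  have hj : Function.Injective
      fun i : Fin 2 => if i = 0 then none else some (Classical.arbitrary ι) := by
    intro i j
    fin_cases i <;> fin_cases j <;> simp
  refine (hC.hasRel_option_exists (hC.hasRel_comap_injective hC.hasRel_diag hj)).congr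
    fun s x => ?_
  simp only [Set.mem_univ, iff_true]
  exact ⟨fun o => o.elim (x (Classical.arbitrary ι)) x, by simp, rfl⟩

theorem hasRel_eq (hC : IsSRelClone C) [Finite ι] (p q : ι) :
    HasRel C (fun _ : S => {x : ι → A | x p = x q}) := by
  have : Nonempty ι := ⟨p⟩
  by_cases hpq : p = q
  · exact hC.hasRel_univ.congr fun s x => by simp [hpq]
  · have hj : Function.Injective ![p, q] := by
      intro i j
      fin_cases i <;> fin_cases j <;> simp [hpq, Ne.symm hpq]
    exact (hC.hasRel_comap_injective hC.hasRel_diag hj).congr fun s x => by simp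

theorem hasRel_forall (hC : IsSRelClone C) [Finite ι] [Nonempty ι] (τ : Type*) [Finite τ]
    {r : τ → S → Set (ι → A)} (h : ∀ t, HasRel C (r t)) :
    HasRel C (fun s => {x | ∀ t, x ∈ r t s}) := by
  induction τ using Finite.induction_empty_option with
  | of_equiv e ih =>
    exact (ih fun a => h (e a)).congr fun s x => e.forall_congr_left.trans (by simp)
  | h_empty => exact hC.hasRel_univ.congr fun s x => by simp
  | h_option ih =>
    exact (hC.hasRel_inter (h none) (ih fun t => h (some t))).congr fun s x => by
      simp [Option.forall]

/-- For non-injective `σ`, take fresh variables `ι` satisfying `r`, equate each `i` with `σ i`, and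
project the fresh variables away. -/
theorem hasRel_comap (hC : IsSRelClone C) [Finite κ] {r : S → Set (ι → A)}
    (h : HasRel C r) (σ : ι → κ) : HasRel C (fun s => {x : κ → A | x ∘ σ ∈ r s}) := by
  have := h.finite
  have : Nonempty ι := by
    obtain ⟨n, e, -⟩ := h
    exact ⟨e 0⟩
  have : Nonempty κ := ⟨σ (Classical.arbitrary ι)⟩
  refine (hC.hasRel_sum_exists ι (hC.hasRel_inter
    (hC.hasRel_comap_injective h (j := Sum.inl) Sum.inl_injective)
    (hC.hasRel_forall ι fun i => hC.hasRel_eq (Sum.inl i) (Sum.inr (σ i))))).congr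
    fun s x => ⟨?_, fun hx => ?_⟩
  · rintro ⟨y, ⟨h1, h2⟩, rfl⟩
    exact Set.mem_of_eq_of_mem (s := r s) (funext fun i => (h2 i).symm) h1
  · exact ⟨Sum.elim (x ∘ σ) x, ⟨hx, fun i => rfl⟩, rfl⟩

theorem hasRel_exists (hC : IsSRelClone C) [Finite ι] [Nonempty ι] {r : S → Set (κ → A)}
    (h : HasRel C r) (σ : ι → κ) : HasRel C (fun s => {x : ι → A | ∃ y ∈ r s, y ∘ σ = x}) := by
  have := h.finite
  refine (hC.hasRel_sum_exists κ (hC.hasRel_inter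
    (hC.hasRel_comap_injective h (j := Sum.inl) Sum.inl_injective)
    (hC.hasRel_forall ι fun i => hC.hasRel_eq (Sum.inl (σ i)) (Sum.inr i)))).congr
    fun s x => ⟨?_, ?_⟩
  · rintro ⟨y, ⟨h1, h2⟩, rfl⟩
    exact ⟨_, h1, funext h2⟩
  · rintro ⟨y, hy, rfl⟩
    exact ⟨Sum.elim y (y ∘ σ), ⟨hy, fun i => rfl⟩, rfl⟩

/-- If the set of projections of each finite arity, regarded as a relation on `A`, is pp-definable
then so is every relation. -/
theorem hasRel_const (hC : IsSRelClone C) [Finite A]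
    (hproj : ∀ (I : Type v) [Finite I] [Nonempty (I → A)],
      HasRel C (fun _ : S => {f : (I → A) → A | ∃ j, ∀ x, f x = x j}))
    [Finite ι] [Nonempty ι] (σ : Set (ι → A)) : HasRel C (fun _ : S => σ) := by
  obtain ⟨n, ⟨e⟩⟩ := exists_finSuccEquiv ι
  have : Nonempty ({x : Fin (n + 1) → A // x ∘ e.symm ∈ σ} → A) := ⟨fun x => x.1 0⟩
  -- Take the tuples of `σ` as columns of a matrix: evaluating the projections at its rows returns
  -- exactly these tuples.
  refine (hC.hasRel_exists (hproj {x : Fin (n + 1) → A // x ∘ e.symm ∈ σ})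
    (fun i x => x.1 (e.symm i))).congr fun s x => ⟨?_, fun hx => ?_⟩
  · rintro ⟨f, ⟨j, hj⟩, rfl⟩
    convert! j.2 using 1
    exact funext fun i => hj _
  · have hx' : (x ∘ e) ∘ e.symm ∈ σ := by simpa [Function.comp_assoc] using hx
    refine ⟨fun g => g ⟨x ∘ e, hx'⟩, ⟨⟨x ∘ e, hx'⟩, fun _ => rfl⟩, ?_⟩
    ext i; simp

/-- A clone containing all constant families, the family with equality at `1` and full elsewhere,
and the unary family empty at `1` and full elsewhere is full. -/
theorem eq_univ_of_hasRel (hC : IsSRelClone C) [Finite S]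
    (hconst : ∀ (n : ℕ) (σ : Set (Fin (n + 1) → A)), HasRel C (fun _ : S => σ))
    (hδ : HasRel C (fun s : S => {x : Fin 2 → A | s = 1 → x 0 = x 1}))
    (hempty : HasRel C (fun s : S => {_x : Fin 1 → A | s ≠ 1})) : C = Set.univ := by
  refine Set.eq_univ_of_forall fun ⟨n, r⟩ => ?_
  have h1 : ∀ σ : Set (Fin (n + 1) → A),
      HasRel C (fun s : S => {x : Fin (n + 1) → A | s = 1 → x ∈ σ}) := by
    intro σ
    -- Projecting "some `y ∈ σ` equals `x` at index `1`" gives full components elsewhere only if `σ`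
    -- is nonempty, hence the separate hypothesis `hempty`.
    rcases σ.eq_empty_or_nonempty with rfl | ⟨z, hz⟩
    · exact (hC.hasRel_comap hempty (fun _ => (0 : Fin (n + 1)))).congr fun s x => by simp
    · refine (hC.hasRel_exists (σ := Sum.inr) (hC.hasRel_inter
        (hC.hasRel_comap (hconst n σ) (Sum.inl : _ → Fin (n + 1) ⊕ Fin (n + 1)))
        (hC.hasRel_forall (Fin (n + 1)) fun i =>
          hC.hasRel_comap hδ ![Sum.inl i, Sum.inr i]))).congr fun s x => ⟨?_, fun hx => ?_⟩
      · rintro ⟨y, ⟨h1, h2⟩, rfl⟩ hs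
        exact Set.mem_of_eq_of_mem (s := σ) (funext fun i => (h2 i hs).symm) h1
      · by_cases hs : s = 1
        · exact ⟨Sum.elim x x, ⟨hx hs, fun i _ => rfl⟩, rfl⟩
        · exact ⟨Sum.elim z x, ⟨hz, fun i h => (hs h).elim⟩, rfl⟩
  have h2 : HasRel C r :=
    -- In `t * v = s` only `t = 1` imposes a condition, so the `v`-th family is `r v` at index `v`
    -- and full elsewhere.
    (hC.hasRel_forall S fun v => hC.hasRel_selfInter (h1 (r v)) v).congr fun s x => by
      constructor
      · intro h
        exact h s 1 (one_mul s) rfl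
      · rintro h v t rfl rfl
        simpa using h
  exact hC.mem_of_hasRel h2 (Equiv.refl _)

end IsSRelClone

/-! ### Finite generating sets of the full relational clone. -/

variable [Monoid S]

theorem isSRelClone_closure (Q : Set (SRel S A)) : IsSRelClone (relCloneClosure Q) where
  diag_mem := fun _ hP => hP.1.diag_mem
  zeta_mem := fun ρ h P hP => hP.1.zeta_mem ρ (h P hP)
  tau_mem := fun ρ h P hP => hP.1.tau_mem ρ (h P hP)
  pr_mem := fun ρ h P hP => hP.1.pr_mem ρ (h P hP)
  prod_mem := fun ρ h σ h' P hP => hP.1.prod_mem ρ (h P hP) σ (h' P hP)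
  inter_mem := fun ρ h σ h' P hP => hP.1.inter_mem ρ (h P hP) σ (h' P hP)
  translate_mem := fun v ρ h P hP => hP.1.translate_mem v ρ (h P hP)
  selfInter_mem := fun v ρ h P hP => hP.1.selfInter_mem v ρ (h P hP)

theorem subset_relCloneClosure (Q : Set (SRel S A)) : Q ⊆ relCloneClosure Q :=
  Set.subset_sInter fun _ hP => hP.2

/-- Being a projection is a condition on triples of arguments, so arity three suffices for every
finite `A`, including those with fewer than three elements. -/
theorem relCloneClosure_arity_le_three [Finite S] [Finite A] :
    relCloneClosure {ρ : SRel S A | ρ.pred ≤ 2} = Set.univ := by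
  have hC := isSRelClone_closure {ρ : SRel S A | ρ.pred ≤ 2}
  have hsub : ∀ {n : ℕ} (r : S → Set (Fin (n + 1) → A)), n ≤ 2 →
      HasRel (relCloneClosure {ρ : SRel S A | ρ.pred ≤ 2}) r :=
    fun r h => hasRel_of_mem (ρ := ⟨_, r⟩) (subset_relCloneClosure _ h)
  refine hC.eq_univ_of_hasRel (fun n σ => hC.hasRel_const ?_ σ) (hsub _ (by simp))
    (hsub _ (by simp))
  intro I _ _
  refine (hC.hasRel_forall ((I → A) × (I → A) × (I → A)) fun p =>
    hC.hasRel_comap (hsub (fun _ => {z : Fin 3 → A | ∃ i, p.1 i = z 0 ∧ p.2.1 i = z 1 ∧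
      p.2.2 i = z 2}) le_rfl) ![p.1, p.2.1, p.2.2]).congr fun s f => ⟨fun h => ?_, ?_⟩
  · have h' : ∀ x y z, ∃ i, x i = f x ∧ y i = f y ∧ z i = f z := fun x y z => h (x, y, z)
    obtain ⟨x₀⟩ := ‹Nonempty (I → A)›
    obtain ⟨i₀, -⟩ := h' x₀ x₀ x₀
    obtain ⟨j, -, hj⟩ := exists_eq_proj_of_forall_three (f := f) (E := Set.univ) ⟨i₀, trivial⟩
      (by simpa using h')
    exact ⟨j, hj⟩
  · rintro ⟨j, hj⟩ p
    exact ⟨j, (hj _).symm, (hj _).symm, (hj _).symm⟩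

theorem exists_finite_relCloneClosure_eq_univ [Finite S] [Finite A] :
    ∃ Q : Set (SRel S A), Q.Finite ∧ relCloneClosure Q = Set.univ := by
  refine ⟨_, ?_, relCloneClosure_arity_le_three⟩
  refine (Set.finite_range (fun p : (Σ n : Fin 3, S → Set (Fin (n.1 + 1) → A)) =>
    (⟨p.1, p.2⟩ : SRel S A))).subset ?_
  rintro ⟨n, r⟩ (h : n ≤ 2)
  exact ⟨⟨⟨n, by omega⟩, r⟩, rfl⟩

theorem relCloneClosure_le_ne [Finite S] {k : ℕ} (hk : 3 ≤ k) :
    relCloneClosure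
      ({SRel.binary (fun x y => x = y) (fun _ _ => True),
        SRel.binary (fun x y => x ≤ y) (fun x y => x ≤ y),
        SRel.binary (fun x y => x ≠ y) (fun x y => x ≠ y)} : Set (SRel S (Fin k))) =
      Set.univ := by
  have hC := isSRelClone_closure
    ({SRel.binary (fun x y => x = y) (fun _ _ => True),
        SRel.binary (fun x y => x ≤ y) (fun x y => x ≤ y),
        SRel.binary (fun x y => x ≠ y) (fun x y => x ≠ y)} : Set (SRel S (Fin k)))
  have hsub := subset_relCloneClosure
    ({SRel.binary (fun x y => x = y) (fun _ _ => True),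
        SRel.binary (fun x y => x ≤ y) (fun x y => x ≤ y),
        SRel.binary (fun x y => x ≠ y) (fun x y => x ≠ y)} : Set (SRel S (Fin k)))
  generalize relCloneClosure
    ({SRel.binary (fun x y => x = y) (fun _ _ => True),
        SRel.binary (fun x y => x ≤ y) (fun x y => x ≤ y),
        SRel.binary (fun x y => x ≠ y) (fun x y => x ≠ y)} : Set (SRel S (Fin k))) = C
    at hC hsub ⊢
  have hδ : HasRel C (fun s : S => {x : Fin 2 → Fin k | s = 1 → x 0 = x 1}) :=
    (hasRel_of_mem (hsub (Or.inl rfl))).congr fun s x => by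
      by_cases hs : s = 1 <;> simp [SRel.binary, hs]
  have hle : HasRel C (fun _ : S => {x : Fin 2 → Fin k | x 0 ≤ x 1}) :=
    (hasRel_of_mem (hsub (Or.inr (Or.inl rfl)))).congr fun s x => by
      simp [SRel.binary]
  have hne : HasRel C (fun _ : S => {x : Fin 2 → Fin k | x 0 ≠ x 1}) :=
    (hasRel_of_mem (hsub (Or.inr (Or.inr rfl)))).congr fun s x => by
      simp [SRel.binary]
  refine hC.eq_univ_of_hasRel (fun n σ => hC.hasRel_const ?_ σ) hδ ?_
  · intro I _ _
    refine (hC.hasRel_inter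
      (hC.hasRel_forall {p : (I → Fin k) × (I → Fin k) // ∀ i, p.1 i ≤ p.2 i} fun p =>
        hC.hasRel_comap hle ![p.1.1, p.1.2])
      (hC.hasRel_forall {p : (I → Fin k) × (I → Fin k) // ∀ i, p.1 i ≠ p.2 i} fun p =>
        hC.hasRel_comap hne ![p.1.1, p.1.2])).congr fun s f => ⟨fun h => ?_, ?_⟩
    · exact exists_eq_proj_of_preserves_le_ne hk (fun x y hxy => h.1 ⟨(x, y), hxy⟩)
        (fun x y hxy => h.2 ⟨(x, y), hxy⟩)
    · rintro ⟨j, hj⟩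
      refine ⟨fun p => ?_, fun p => ?_⟩
      · simpa [hj] using p.2 j
      · simpa [hj] using p.2 j
  -- Inequality contradicts equality at index `1`; at other indices every element differs from some
  -- other one.
  · refine (hC.hasRel_exists (hC.hasRel_inter hne hδ) (fun _ : Fin 1 => 0)).congr
      fun s x => ⟨?_, fun hs => ?_⟩
    · rintro ⟨y, ⟨h1, h2⟩, -⟩ hs
      exact h1 (h2 hs)
    · have : Nontrivial (Fin k) := Fin.nontrivial_iff_two_le.2 (by omega)
      obtain ⟨b, hb⟩ := exists_ne (x 0)
      refine ⟨![x 0, b], ⟨by simpa using hb.symm, fun h => (hs h).elim⟩, ?_⟩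
      ext i
      rw [Subsingleton.elim i 0]
      rfl

end Relations

/-! ### Atoms and coatoms of the lattice of preclones. -/

section PrecloneLattice

theorem SOp.finite_setOf_pred_le {S : Type u} {A : Type v} [Finite S] [Finite A] (N : ℕ) :
    {f : SOp S A | f.pred ≤ N}.Finite := by
  refine (Set.finite_range
    (fun p : (Σ n : Fin (N + 1), (Fin (n.1 + 1) → S) × ((Fin (n.1 + 1) → A) → A)) =>
      (⟨p.1, p.2.1, p.2.2⟩ : SOp S A))).subset ?_
  rintro ⟨n, sgn, fn⟩ (h : n ≤ N)
  exact ⟨⟨⟨n, by omega⟩, sgn, fn⟩, rfl⟩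

variable {S : Type u} {A : Type v} [Monoid S] {F : Set (SOp S A)}

/-- A projection to a coordinate labelled by the neutral element. -/
def SOp.IsProj (f : SOp S A) : Prop :=
  ∃ i, f.sgn i = 1 ∧ ∀ x, f.fn x = x i

theorem isSPreclone_isProj : IsSPreclone {f : SOp S A | f.IsProj} where
  id_mem := ⟨(0 : Fin 1), rfl, fun _ => rfl⟩
  zeta_mem := by
    rintro f ⟨i, hi, h⟩
    refine ⟨(i + 1 : Fin (f.pred + 1)), ?_, fun x => h _⟩
    simpa [SOp.zeta] using hi
  tau_mem := by
    rintro f ⟨i, hi, h⟩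
    refine ⟨Equiv.swap 0 1 i, ?_, fun x => h _⟩
    change f.sgn (Equiv.swap 0 1 (Equiv.swap 0 1 i)) = 1
    rwa [← Equiv.Perm.mul_apply, Equiv.swap_mul_self]
  nabla_mem := by
    rintro s f ⟨i, hi, h⟩
    exact ⟨Fin.succ i, by simpa [SOp.nabla] using hi, fun x => h _⟩
  delta_mem := by
    rintro ⟨_ | n, sgn, fn⟩ ⟨i, hi, h⟩
    · exact ⟨i, hi, h⟩
    · change SOp.IsProj (SOp.delta _)
      rw [SOp.delta]
      split_ifs with h01
      · change Fin (n + 2) at i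
        rcases Fin.eq_zero_or_eq_succ i with rfl | ⟨j, rfl⟩
        · exact ⟨(0 : Fin (n + 1)), h01.symm.trans hi, fun x => h _⟩
        · exact ⟨j, hi, fun x => h _⟩
      · exact ⟨i, hi, h⟩
  comp_mem := by
    rintro ⟨n, sf, f⟩ ⟨i, hi, hf⟩ ⟨m, sg, g⟩ ⟨j, hj, hg⟩
    change Fin (n + 1) at i
    change Fin (m + 1) at j
    change sf i = 1 at hi
    change sg j = 1 at hj
    change ∀ x, f x = x i at hf
    change ∀ x, g x = x j at hg
    rcases Fin.eq_zero_or_eq_succ i with rfl | ⟨i, rfl⟩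
    · refine ⟨(⟨j, by omega⟩ : Fin (m + n + 1)), ?_, fun x => ?_⟩
      · have : (j : ℕ) < m + 1 := j.2
        simp [SOp.comp, hi, hj]
        omega
      · simp [SOp.comp, hf, hg]
    · refine ⟨(⟨m + 1 + i, by omega⟩ : Fin (m + n + 1)), ?_, fun x => ?_⟩
      · have h2 : ∀ h : m + 1 + (i : ℕ) - m < n + 1, (⟨m + 1 + i - m, h⟩ : Fin (n + 1)) = i.succ := by
          intro h; ext; simp; omega
        have h3 : ¬ m + 1 + (i : ℕ) ≤ m := by omega
        simp [SOp.comp, h2, h3, hi]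
      · simp [SOp.comp, hf]

theorem IsSPreclone.mem_of_isProj (hF : IsSPreclone F) {f : SOp S A} (hf : f.IsProj) : f ∈ F := by
  obtain ⟨i, hi, h⟩ := hf
  rw [show f = ⟨f.pred, f.sgn, fun x => x i⟩ from SOp.ext rfl HEq.rfl (heq_of_eq (funext h))]
  exact hF.mem_of_hasOp (hF.hasOp_proj hi) (Equiv.refl _)

theorem IsSPreclone.exists_minor_not_isProj (hF : IsSPreclone F) {f : SOp S A} (hf : f ∈ F)
    {K : Type*} [Finite K] (φ : Fin (f.pred + 1) → K) (l : K → S) (hl : ∀ i, l (φ i) = f.sgn i)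
    (h : ∀ i, f.sgn i = 1 → ∃ w : K → A, f.fn (w ∘ φ) ≠ w (φ i)) :
    ∃ g ∈ F, ¬ g.IsProj ∧ g.pred ≤ Nat.card K := by
  -- Working on the range of `φ` makes every argument of the minor come from an argument of `f`, so
  -- that `h` rules out each projection.
  have : Nonempty (Set.range φ) := ⟨⟨φ 0, 0, rfl⟩⟩
  obtain ⟨n, ⟨e⟩⟩ := exists_finSuccEquiv (Set.range φ)
  have hg := hF.mem_of_hasOp (hF.hasOp_minor (hasOp_of_mem hf) (Set.rangeFactorization φ)
    (sgn' := fun k => l k) hl) e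
  refine ⟨_, hg, ?_, ?_⟩
  · rintro ⟨i₀, h1, h2⟩
    obtain ⟨i, hi⟩ := (e i₀).2
    obtain ⟨w, hw⟩ := h i (by rw [← hl, hi]; exact h1)
    apply hw
    rw [hi]
    convert! h2 (fun j => w (e j)) using 1
    refine congrArg f.fn (funext fun j => ?_)
    simp [Set.rangeFactorization]
  · have h1 := Nat.card_congr e
    have h2 := Finite.card_range_le φ
    have h3 : Nat.card (Set.range φ) ≤ Nat.card K :=
      Nat.card_le_card_of_injective _ Subtype.val_injective
    rw [Nat.card_fin] at h1
    change n ≤ _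
    omega

/-- A signed operation that is not a projection to a coordinate labelled by the neutral element has
a minor of bounded arity that is not such a projection either. -/
theorem IsSPreclone.exists_not_isProj_pred_le (hF : IsSPreclone F) [Finite S] [Finite A]
    {f : SOp S A} (hf : f ∈ F) (h : ¬ f.IsProj) :
    ∃ g ∈ F, ¬ g.IsProj ∧ g.pred ≤ max (Nat.card S) (Nat.card (S × A × A × A)) := by
  rcases Set.eq_empty_or_nonempty {i | f.sgn i = 1} with hE | hE
  -- With no label `1`, merging all arguments of equal label cannot create one.
  · obtain ⟨g, hg, h1, h2⟩ := hF.exists_minor_not_isProj hf f.sgn id (fun _ => rfl)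
      fun i hi => (Set.eq_empty_iff_forall_notMem.1 hE i hi).elim
    exact ⟨g, hg, h1, h2.trans (le_max_left _ _)⟩
  · obtain ⟨x, y, z, hxyz⟩ : ∃ x y z, ∀ i, f.sgn i = 1 →
        ¬ (x i = f.fn x ∧ y i = f.fn y ∧ z i = f.fn z) := by
      by_contra! h'
      obtain ⟨j, hj, h2⟩ := exists_eq_proj_of_forall_three hE h'
      exact h ⟨j, hj, h2⟩
    -- Merging arguments that agree in label and in `x`, `y`, `z` keeps these three tuples available
    -- as witnesses.
    obtain ⟨g, hg, h1, h2⟩ := hF.exists_minor_not_isProj hf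
      (fun i => (f.sgn i, x i, y i, z i)) Prod.fst (fun _ => rfl) fun i hi => by
        by_contra! hw
        exact hxyz i hi ⟨(hw fun p => p.2.1).symm, (hw fun p => p.2.2.1).symm,
          (hw fun p => p.2.2.2).symm⟩
    exact ⟨g, hg, h1, h2.trans (le_max_right _ _)⟩

namespace SPreclone

theorem le_bot_of_forall_isProj {P : SPreclone S A} (h : ∀ f ∈ P.1, f.IsProj) : P = ⊥ :=
  le_bot_iff.1 fun f hf => (⊥ : SPreclone S A).2.mem_of_isProj (h f hf)

theorem isProj_of_mem_bot {f : SOp S A} (hf : f ∈ (⊥ : SPreclone S A).1) : f.IsProj :=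
  (bot_le : (⊥ : SPreclone S A) ≤ ⟨_, isSPreclone_isProj⟩) hf

/-- Every nontrivial preclone contains a nontrivial operation of bounded arity. There are finitely
many of these, so a minimal preclone generated by one of them inside `P` is an atom. -/
instance isAtomic [Finite S] [Finite A] : IsAtomic (SPreclone S A) := by
  refine ⟨fun P => or_iff_not_imp_left.2 fun hP => ?_⟩
  have key : ∀ R : SPreclone S A, R ≠ ⊥ → ∃ g ∈ R.1, ¬ g.IsProj ∧
      g.pred ≤ max (Nat.card S) (Nat.card (S × A × A × A)) := fun R hR => by
    have : ∃ f ∈ R.1, ¬ f.IsProj := by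
      by_contra! h
      exact hR (le_bot_of_forall_isProj h)
    obtain ⟨f, hf, h⟩ := this
    exact R.2.exists_not_isProj_pred_le hf h
  let gen : SOp S A → SPreclone S A := fun f => ⟨_, isSPreclone_closure {f}⟩
  have hgen : ∀ {f} {R : SPreclone S A}, f ∈ R.1 → gen f ≤ R := fun {f R} h =>
    precloneClosure_subset R.2 (Set.singleton_subset_iff.2 h)
  have hmem : ∀ f, f ∈ (gen f).1 := fun f => subset_precloneClosure _ rfl
  let T : Set (SOp S A) := {g | g.pred ≤ max (Nat.card S) (Nat.card (S × A × A × A)) ∧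
    (¬ g.IsProj ∧ g ∈ P.1)}
  have hT : T.Finite := (SOp.finite_setOf_pred_le _).subset fun g hg => hg.1
  obtain ⟨g₀, h1, h2, h3⟩ := key P hP
  obtain ⟨Q, hQ⟩ := (hT.image gen).exists_minimal ⟨_, g₀, ⟨h3, h2, h1⟩, rfl⟩
  obtain ⟨g, ⟨hg1, hg2, hg3⟩, rfl⟩ := hQ.1
  refine ⟨gen g, ⟨fun h => hg2 (isProj_of_mem_bot (h ▸ hmem g)), fun R hR => ?_⟩, hgen hg3⟩
  by_contra hne
  obtain ⟨g', h1', h2', h3'⟩ := key R hne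
  have hle : gen g ≤ gen g' :=
    hQ.2 ⟨g', ⟨h3', h2', hgen hg3 (hR.le h1')⟩, rfl⟩ ((hgen h1').trans hR.le)
  exact hR.not_ge (hle.trans (hgen h1'))

theorem coe_top : (⊤ : SPreclone S A).1 = Set.univ :=
  Set.eq_univ_of_univ_subset
    (le_top : (⟨Set.univ, ⟨trivial, fun _ _ => trivial, fun _ _ => trivial, fun _ _ _ => trivial,
      fun _ _ => trivial, fun _ _ _ _ => trivial⟩⟩ : SPreclone S A) ≤ ⊤)

/-- If the union of a chain were full, the finitely many generators of the full preclone would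
already lie in one member. -/
instance isCoatomic [Finite S] [Finite A] : IsCoatomic (SPreclone S A) := by
  refine IsCoatomic.of_isChain_bounded fun c hc hne htop => ?_
  have hU : IsSPreclone (⋃₀ (Subtype.val '' c : Set (Set (SOp S A)))) := by
    obtain ⟨P₀, hP₀⟩ := hne
    refine ⟨⟨_, ⟨P₀, hP₀, rfl⟩, P₀.2.id_mem⟩, ?_, ?_, ?_, ?_, ?_⟩
    · rintro f ⟨_, ⟨P, hP, rfl⟩, hf⟩
      exact ⟨_, ⟨P, hP, rfl⟩, P.2.zeta_mem f hf⟩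
    · rintro f ⟨_, ⟨P, hP, rfl⟩, hf⟩
      exact ⟨_, ⟨P, hP, rfl⟩, P.2.tau_mem f hf⟩
    · rintro s f ⟨_, ⟨P, hP, rfl⟩, hf⟩
      exact ⟨_, ⟨P, hP, rfl⟩, P.2.nabla_mem s f hf⟩
    · rintro f ⟨_, ⟨P, hP, rfl⟩, hf⟩
      exact ⟨_, ⟨P, hP, rfl⟩, P.2.delta_mem f hf⟩
    · rintro f ⟨_, ⟨P, hP, rfl⟩, hf⟩ g ⟨_, ⟨R, hR, rfl⟩, hg⟩
      rcases hc.total hP hR with h | h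
      · exact ⟨_, ⟨R, hR, rfl⟩, R.2.comp_mem f (h hf) g hg⟩
      · exact ⟨_, ⟨P, hP, rfl⟩, P.2.comp_mem f hf g (h hg)⟩
  refine ⟨⟨_, hU⟩, fun h => ?_, fun P hP => Set.subset_sUnion_of_mem ⟨P, hP, rfl⟩⟩
  obtain ⟨G, hG, hgen⟩ := exists_finite_precloneClosure_eq_univ (S := S) (A := A)
  have hsub : G ⊆ ⋃₀ (Subtype.val '' c : Set (Set (SOp S A))) := by
    rw [show ⋃₀ (Subtype.val '' c : Set (Set (SOp S A))) = Set.univ from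
      (congrArg Subtype.val h).trans coe_top]
    exact Set.subset_univ _
  have hdir : DirectedOn (· ⊆ ·) (Subtype.val '' c : Set (Set (SOp S A))) := by
    rintro _ ⟨P, hP, rfl⟩ _ ⟨R, hR, rfl⟩
    rcases hc.total hP hR with h | h
    · exact ⟨_, ⟨R, hR, rfl⟩, h, subset_rfl⟩
    · exact ⟨_, ⟨P, hP, rfl⟩, subset_rfl, h⟩
  obtain ⟨_, ⟨P, hP, rfl⟩, hGP⟩ :=
    hdir.exists_mem_subset_of_finite_of_subset_sUnion (hne.image _) hG hsub
  have hPtop : P = ⊤ := top_le_iff.1 fun f _ =>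
    precloneClosure_subset P.2 hGP (hgen.symm ▸ Set.mem_univ f)
  exact htop (hPtop ▸ hP)

end SPreclone

end PrecloneLattice

theorem proposition5p1 (S : Type u) [Monoid S] [Finite S] (A : Type v) [Finite A] :
    -- (1) the full `S`-preclone is finitely generated
    (∃ F : Set (SOp S A), F.Finite ∧ precloneClosure F = Set.univ) ∧
    (∀ k : ℕ,
      precloneClosure
        (({SOp.binary (1 : S) 1 (webb k)} : Set (SOp S (Fin k))) ∪
          Set.range (fun s : S => SOp.idOp (Fin k) s)) = Set.univ) ∧
    -- (2) the full `S`-relational clone is finitely generated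
    (∃ Q : Set (SRel S A), Q.Finite ∧ relCloneClosure Q = Set.univ) ∧
    (∀ k : ℕ, 3 ≤ k →
      relCloneClosure
        ({SRel.binary (fun x y => x = y) (fun _ _ => True),
          SRel.binary (fun x y => x ≤ y) (fun x y => x ≤ y),
          SRel.binary (fun x y => x ≠ y) (fun x y => x ≠ y)} : Set (SRel S (Fin k))) =
        Set.univ) ∧
    -- (3) the lattice of `S`-preclones is atomic and coatomic
    IsAtomic (SPreclone S A) ∧ IsCoatomic (SPreclone S A) :=
  ⟨exists_finite_precloneClosure_eq_univ, fun k => precloneClosure_webb (Equiv.refl (Fin k)),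
    exists_finite_relCloneClosure_eq_univ, fun _ => relCloneClosure_le_ne,
    inferInstance, inferInstance⟩
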